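/- Let $\triangle\subset\mathbb C$ be the open unit disk. For a complex manifold $X$, a point $x\in X$ and a tangent vector $v\in T_xX$, let $$\omega_K^X(x,v)=\inf\{1/\lambda : \lambda>0,\ f:\triangle\to X \text{ holomorphic},\ f(0)=x,\ df(0)(1)=\lambda v\}$$ be the Kobayashi metric, and let the injective Kobayashi metric $\omega_\iota^X(x,v)$ be the same infimum taken over the injective holomorphic maps $f:\triangle\to X$ only. Call a subgroup $\Gamma$ of the holomorphic automorphism group $\mathrm{Aut}_{\mathrm{hol}}(\triangle)$ a Fuchsian group if every $z\in\triangle$ has an open neighbourhood $U$ such that $\varphi\in\Gamma$ and $\varphi(U)\cap U\neq\emptyset$ imply $\varphi=\mathrm{id}$. **Theorem (Jarnicki).** Let $\Gamma_1,\Gamma_2\subset\mathrm{Aut}_{\mathrm{hol}}(\triangle)$ be Fuchsian groups, let $\Gamma=\Gamma_1\oplus\Gamma_2$ be the group of all automorphisms $(z,w)\mapsto(\varphi_1(z),\varphi_2(w))$ of $\triangle^2$ with $\varphi_j\in\Gamma_j$, and let $X=\triangle^2/\Gamma$ be the quotient complex manifold. Suppose that there is at least one element $\phi=(\varphi_1,\varphi_2)\in\Gamma$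 with $\varphi_1\neq\mathrm{id}$ and $\varphi_2\neq\mathrm{id}$. Then $\omega_\iota^X\neq\omega_K^X$, that is, there are $x\in X$ and $v\in T_xX$ with $\omega_\iota^X(x,v)\neq\omega_K^X(x,v)$. -/

import Mathlib

open scoped Manifold ContDiff Topology

/-! ### Holomorphic automorphism groups -/

section Automorphisms

variable {E : Type*} [NormedAddCommGroup E] [NormedSpace ℂ E]
  {H : Type*} [TopologicalSpace H]
  {E' : Type*} [NormedAddCommGroup E'] [NormedSpace ℂ E']
  {H' : Type*} [TopologicalSpace H']

/-- The group of holomorphic automorphisms (biholomorphic self-maps) of a complex manifold `M`. -/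
noncomputable def AutHol (I : ModelWithCorners ℂ E H) (M : Type*) [TopologicalSpace M] [ChartedSpace H M] :
    Subgroup (M ≃ₜ M) where
  carrier := {φ | ContMDiff I I ω φ ∧ ContMDiff I I ω φ.symm}
  one_mem' := ⟨contMDiff_id, contMDiff_id⟩
  mul_mem' := fun {_ _} ha hb => ⟨ha.1.comp hb.1, hb.2.comp ha.2⟩
  inv_mem' := fun {_} ha => ⟨ha.2, ha.1⟩

/-- The tautological action of the automorphism group on the manifold. -/
noncomputable instance AutHol.instMulAction (I : ModelWithCorners ℂ E H) (M : Type*) [TopologicalSpace M]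
    [ChartedSpace H M] : MulAction (AutHol I M) M where
  smul φ z := φ.1 z
  one_smul _ := rfl
  mul_smul _ _ _ := rfl

/-- The automorphism `(z, w) ↦ (φ₁ z, φ₂ w)` of a product, as a homomorphism in `(φ₁, φ₂)`. -/
noncomputable def AutHol.prodHom (I : ModelWithCorners ℂ E H) (M : Type*) [TopologicalSpace M]
    [ChartedSpace H M] (J : ModelWithCorners ℂ E' H') (N : Type*) [TopologicalSpace N]
    [ChartedSpace H' N] : AutHol I M × AutHol J N →* AutHol (I.prod J) (M × N) where
  toFun φ := ⟨φ.1.1.prodCongr φ.2.1,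
    φ.1.2.1.prodMap φ.2.2.1, φ.1.2.2.prodMap φ.2.2.2⟩
  map_one' := rfl
  map_mul' _ _ := rfl

/-- The direct sum `Γ₁ ⊕ Γ₂`: all automorphisms `(z, w) ↦ (φ₁ z, φ₂ w)` of `M × N` with
`φ₁ ∈ Γ₁` and `φ₂ ∈ Γ₂`. -/
noncomputable def AutHol.directSum {I : ModelWithCorners ℂ E H} {M : Type*} [TopologicalSpace M]
    [ChartedSpace H M] {J : ModelWithCorners ℂ E' H'} {N : Type*} [TopologicalSpace N]
    [ChartedSpace H' N] (Γ₁ : Subgroup (AutHol I M)) (Γ₂ : Subgroup (AutHol J N)) :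
    Subgroup (AutHol (I.prod J) (M × N)) :=
  (Γ₁.prod Γ₂).map (AutHol.prodHom I M J N)

/-- A group `Γ` of holomorphic automorphisms of `M` acts (freely and) properly discontinuously:
every point has an open neighbourhood `U` such that `φ ∈ Γ` and `φ(U) ∩ U ≠ ∅` imply `φ = id`.
Such groups are called Kleinian, and Fuchsian when `M` is the unit disk. -/
class AutHol.IsKleinian {I : ModelWithCorners ℂ E H} {M : Type*} [TopologicalSpace M]
    [ChartedSpace H M] (Γ : Subgroup (AutHol I M)) : Prop where
  exists_open : ∀ z : M, ∃ U : Set M, IsOpen U ∧ z ∈ U ∧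
    ∀ φ ∈ Γ, (((fun w => φ • w) '' U) ∩ U).Nonempty → φ = 1

instance AutHol.directSum.instIsKleinian {I : ModelWithCorners ℂ E H} {M : Type*}
    [TopologicalSpace M] [ChartedSpace H M] {J : ModelWithCorners ℂ E' H'} {N : Type*}
    [TopologicalSpace N] [ChartedSpace H' N] (Γ₁ : Subgroup (AutHol I M))
    (Γ₂ : Subgroup (AutHol J N)) [h₁ : AutHol.IsKleinian Γ₁] [h₂ : AutHol.IsKleinian Γ₂] :
    AutHol.IsKleinian (AutHol.directSum Γ₁ Γ₂) where
  exists_open := by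
    rintro ⟨z, w⟩
    obtain ⟨U, hU, hz, hU'⟩ := h₁.exists_open z
    obtain ⟨V, hV, hw, hV'⟩ := h₂.exists_open w
    refine ⟨U ×ˢ V, hU.prod hV, ⟨hz, hw⟩, ?_⟩
    rintro _ ⟨⟨φ₁, φ₂⟩, ⟨hφ₁, hφ₂⟩, rfl⟩ ⟨_, ⟨⟨a, b⟩, ⟨ha, hb⟩, rfl⟩, ha', hb'⟩
    have e₁ : φ₁ = 1 := hU' φ₁ hφ₁ ⟨φ₁ • a, ⟨a, ha, rfl⟩, ha'⟩
    have e₂ : φ₂ = 1 := hV' φ₂ hφ₂ ⟨φ₂ • b, ⟨b, hb, rfl⟩, hb'⟩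
    subst e₁ e₂
    exact map_one _

end Automorphisms

/-! ### The quotient manifold -/

section Quotient

variable {E : Type*} [NormedAddCommGroup E] [NormedSpace ℂ E]
  {H : Type*} [TopologicalSpace H] {I : ModelWithCorners ℂ E H}
  {M : Type*} [TopologicalSpace M] [ChartedSpace H M]

/-- The orbit space `M / Γ`. -/
noncomputable def AutHol.Quotient (Γ : Subgroup (AutHol I M)) : Type _ :=
  MulAction.orbitRel.Quotient Γ M

/-- The quotient topology. -/
instance (Γ : Subgroup (AutHol I M)) : TopologicalSpace (AutHol.Quotient Γ) :=
  inferInstanceAs (TopologicalSpace (_root_.Quotient (MulAction.orbitRel Γ M)))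

/-- The projection `π : M → M / Γ`. -/
noncomputable def AutHol.Quotient.mk (Γ : Subgroup (AutHol I M)) : M → AutHol.Quotient Γ :=
  _root_.Quotient.mk (MulAction.orbitRel Γ M)

theorem AutHol.Quotient.mk_eq_iff (Γ : Subgroup (AutHol I M)) {a b : M} :
    mk Γ a = mk Γ b ↔ ∃ φ ∈ Γ, φ • b = a := by
  refine (_root_.Quotient.eq (r := MulAction.orbitRel Γ M)).trans ?_
  constructor
  · rintro ⟨φ, hφ⟩
    exact ⟨φ.1, φ.2, hφ⟩
  · rintro ⟨φ, hφ, h⟩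
    exact ⟨⟨φ, hφ⟩, h⟩

theorem AutHol.Quotient.mk_surjective (Γ : Subgroup (AutHol I M)) :
    Function.Surjective (mk Γ) :=
  _root_.Quotient.mk_surjective

theorem AutHol.Quotient.isQuotientCoveringMap_mk (Γ : Subgroup (AutHol I M))
    [h : AutHol.IsKleinian Γ] : IsQuotientCoveringMap (mk Γ) Γ where
  toIsQuotientMap := isQuotientMap_quotient_mk'
  continuous_const_smul := fun γ => γ.1.1.continuous
  apply_eq_iff_mem_orbit :=
    _root_.Quotient.eq (r := MulAction.orbitRel Γ M)
  disjoint := fun z => by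
    obtain ⟨U, hU, hz, h'⟩ := h.exists_open z
    exact ⟨U, hU.mem_nhds hz, fun g hg => Subtype.ext (h' g.1 g.2 hg)⟩

theorem AutHol.Quotient.isLocalHomeomorph_mk (Γ : Subgroup (AutHol I M))
    [AutHol.IsKleinian Γ] : IsLocalHomeomorph (mk Γ) :=
  (isQuotientCoveringMap_mk Γ).isCoveringMap.isLocalHomeomorph

/-- The charts of `M / Γ` are the local inverses of the projection followed by charts of `M`. -/
noncomputable instance (Γ : Subgroup (AutHol I M)) [AutHol.IsKleinian Γ] :
    ChartedSpace H (AutHol.Quotient Γ) :=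
  (AutHol.Quotient.isLocalHomeomorph_mk Γ).chartedSpace (AutHol.Quotient.mk_surjective Γ)

/-- The transition maps of `M / Γ` are locally elements of `Γ` read in charts of `M`, so `M / Γ` is
a complex manifold. -/
instance (Γ : Subgroup (AutHol I M)) [AutHol.IsKleinian Γ] [IsManifold I ω M] :
    IsManifold I ω (AutHol.Quotient Γ) := by
  apply isManifold_of_contDiffOn
  rintro _ _ ⟨q, rfl⟩ ⟨q', rfl⟩
  have hπ := AutHol.Quotient.isLocalHomeomorph_mk Γ
  set p := (AutHol.Quotient.mk_surjective Γ).hasRightInverse.choose q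
  set p' := (AutHol.Quotient.mk_surjective Γ).hasRightInverse.choose q'
  set s := hπ.localInverseAt p
  set s' := hπ.localInverseAt p'
  have hs : (s.symm : M → AutHol.Quotient Γ) = AutHol.Quotient.mk Γ := hπ.localInverseAt_symm p
  have hs' : (s'.symm : M → AutHol.Quotient Γ) = AutHol.Quotient.mk Γ := hπ.localInverseAt_symm p'
  rintro x ⟨hx, hxI⟩
  refine ContDiffWithinAt.mono ?_ Set.inter_subset_right
  simp only [Set.mem_preimage, OpenPartialHomeomorph.trans_source,
    OpenPartialHomeomorph.trans_symm_eq_symm_trans_symm, OpenPartialHomeomorph.symm_source,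
    OpenPartialHomeomorph.coe_trans, Set.mem_inter_iff, Function.comp_apply] at hx
  rw [hs] at hx
  obtain ⟨⟨hx₁, hx₂⟩, hx₃, hx₄⟩ := hx
  set m := (chartAt H p).symm (I.symm x) with hm
  -- the element of `Γ` relating the two local sections
  obtain ⟨φ, hφ, hφm⟩ := (AutHol.Quotient.mk_eq_iff Γ).1
    (hπ.apply_localInverseAt_of_mem hx₃ : AutHol.Quotient.mk Γ (s' (AutHol.Quotient.mk Γ m)) = _)
  have hmc : ContinuousAt (fun y => (chartAt H p).symm (I.symm y)) x :=
    ((chartAt H p).continuousAt_symm hx₁).comp I.continuous_symm.continuousAt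
  have hφc : Continuous (fun z : M => φ • z) := φ.1.continuous
  have key : ∀ᶠ z in 𝓝 m, s' (AutHol.Quotient.mk Γ z) = φ • z := by
    have h1 : ∀ᶠ z in 𝓝 m, AutHol.Quotient.mk Γ z ∈ s'.source :=
      hπ.continuous.continuousAt.eventually (s'.open_source.mem_nhds hx₃)
    have h2 : ∀ᶠ z in 𝓝 m, φ • z ∈ s'.target := by
      refine hφc.continuousAt.eventually (s'.open_target.mem_nhds ?_)
      change φ • m ∈ s'.target
      rw [hφm]
      exact s'.map_source hx₃
    filter_upwards [h1, h2] with z hz1 hz2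
    refine hπ.injOn_localInverseAt_target (x := p') (s'.map_source hz1) hz2 ?_
    rw [hπ.apply_localInverseAt_of_mem hz1]
    exact ((AutHol.Quotient.mk_eq_iff Γ).2 ⟨φ, hφ, rfl⟩).symm
  have hsm : ContMDiffWithinAt 𝓘(ℂ, E) 𝓘(ℂ, E) ω
      (fun y => I (chartAt H p' (φ • ((chartAt H p).symm (I.symm y))))) (Set.range I) x := by
    have h1 : ContMDiffWithinAt 𝓘(ℂ, E) I ω I.symm (Set.range I) x :=
      I.contMDiffOn_symm x hxI
    have h2 : ContMDiffAt I I ω (chartAt H p).symm (I.symm x) :=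
      (contMDiffOn_chart_symm (I := I) (n := ω) (x := p)).contMDiffAt
        ((chartAt H p).open_target.mem_nhds hx₁)
    have h3 : ContMDiffAt I I ω (fun z : M => φ • z) m := φ.2.1 m
    have h4 : ContMDiffAt I I ω (chartAt H p') (φ • m) := by
      refine (contMDiffOn_chart (I := I) (n := ω) (x := p')).contMDiffAt
        ((chartAt H p').open_source.mem_nhds ?_)
      rw [hφm]
      exact hx₄
    have h5 : ContMDiffAt I 𝓘(ℂ, E) ω I (chartAt H p' (φ • m)) := I.contMDiff _
    exact h5.comp_contMDiffWithinAt x (h4.comp_contMDiffWithinAt x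
      (h3.comp_contMDiffWithinAt x (h2.comp_contMDiffWithinAt x h1)))
  refine (contMDiffWithinAt_iff_contDiffWithinAt.1 hsm).congr_of_eventuallyEq ?_ ?_
  · filter_upwards [mem_nhdsWithin_of_mem_nhds (hmc.eventually key)] with y hy
    simp only [OpenPartialHomeomorph.trans_symm_eq_symm_trans_symm,
      OpenPartialHomeomorph.coe_trans, Function.comp_apply]
    rw [hs, hy]
  · simp only [OpenPartialHomeomorph.trans_symm_eq_symm_trans_symm,
      OpenPartialHomeomorph.coe_trans, Function.comp_apply]
    rw [hs, key.self_of_nhds]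

end Quotient

/-! ### The unit disk and the two metrics -/

/-- The open unit disk `△` in `ℂ`, an open submanifold of `ℂ`. -/
abbrev Disk : Type :=
  (⟨Metric.ball (0 : ℂ) 1, Metric.isOpen_ball⟩ : TopologicalSpace.Opens ℂ)

/-- The centre of the unit disk. -/
instance : Zero Disk := ⟨⟨0, Metric.mem_ball_self one_pos⟩⟩

/-- A Fuchsian group: a group of holomorphic automorphisms of the unit disk acting (freely and)
properly discontinuously. -/
abbrev IsFuchsian (Γ : Subgroup (AutHol 𝓘(ℂ) Disk)) : Prop := AutHol.IsKleinian Γ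

section Metrics

variable {E : Type*} [NormedAddCommGroup E] [NormedSpace ℂ E] {H : Type*} [TopologicalSpace H]

/-- The Kobayashi metric `ω_K(x, v) = inf {1 / lam}`, over all holomorphic `f : △ → X` and `lam > 0`
with `f(0) = x` and `df(0)(1) = lam v`. -/
noncomputable def kobayashiMetric (I : ModelWithCorners ℂ E H) (X : Type*) [TopologicalSpace X]
    [ChartedSpace H X] [IsManifold I ω X] (p : TangentBundle I X) : ℝ :=
  sInf {r : ℝ | ∃ (f : Disk → X) (lam : ℝ), ContMDiff 𝓘(ℂ) I ω f ∧ 0 < lam ∧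
    tangentMap 𝓘(ℂ) I f ⟨0, (1 : ℂ)⟩ = ⟨p.1, (lam : ℂ) • p.2⟩ ∧ r = 1 / lam}

/-- The injective Kobayashi metric `ω_ι`: as `ω_K`, but over injective holomorphic `f` only. -/
noncomputable def injectiveKobayashiMetric (I : ModelWithCorners ℂ E H) (X : Type*)
    [TopologicalSpace X] [ChartedSpace H X] [IsManifold I ω X] (p : TangentBundle I X) : ℝ :=
  sInf {r : ℝ | ∃ (f : Disk → X) (lam : ℝ), ContMDiff 𝓘(ℂ) I ω f ∧ Function.Injective f ∧ 0 < lam ∧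
    tangentMap 𝓘(ℂ) I f ⟨0, (1 : ℂ)⟩ = ⟨p.1, (lam : ℂ) • p.2⟩ ∧ r = 1 / lam}

end Metrics

/-! Push the vector (1, 1) at the origin of the bidisk down to X, along an automorphism `T = (a, b)`
followed by the covering. The Kobayashi metric there is 1: the diagonal disc attains it, and the
Schwarz lemma in one coordinate forbids less. For suitable `T` the injective metric is not 1.

An injective disc with `lam` close to 1 lifts to the bidisk and, in the coordinates given by `T`,
becomes a pair G₁, G₂ of self-maps of the disk fixing 0 with derivative `lam`. Such maps are close
to the identity on smaller disks, with their difference quotients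
(`IsNormalizedSelfMap.norm_sub_sub_sub_le`). Put A = a⁻¹φ₁a and B = b⁻¹ψb with φ₁ ∈ Γ₁, ψ ∈ Γ₂. If
G₁ζ = A(G₁ζ') and G₂ζ = B(G₂ζ'), the disc takes one value at ζ and ζ', while ζ ≠ ζ' because φ₁ has
no fixed point. When A(0) = B(0) = c, the diagonal disc has the solution (ζ, ζ') = (c, 0). When also
A'(0) ≠ B'(0), the graphs of A and B cross transversally there, so a solution survives small
perturbations (`exists_common_solution_of_deriv_ne`). Hence no injective disc has `lam` near 1.

The choice of a, b, ψ is `AutHol.exists_conj_smul_zero_eq_and_deriv_ne`. Moving the base point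
towards the boundary lets |A(0)| and |B(0)| take any common value close enough to 1, and a rotation
then makes A(0) = B(0). This fixes the moduli of the derivatives. If their arguments also coincide,
ψ = φ₂⁻¹ replaces ψ = φ₂: this conjugates B'(0), which was arranged to be non-real. -/

/-! ### Discs that are almost extremal for the Schwarz lemma -/

section NearlyExtremal

open Metric Set

/-- A holomorphic self-map `g` of the unit disk with `g 0 = 0` whose derivative at `0` is the real
number `t`. -/
structure IsNormalizedSelfMap (g : ℂ → ℂ) (t : ℝ) : Prop where
  differentiableOn : DifferentiableOn ℂ g (ball 0 1)
  mapsTo : MapsTo g (ball 0 1) (ball 0 1)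
  map_zero : g 0 = 0
  deriv_zero : deriv g 0 = (t : ℂ)

namespace IsNormalizedSelfMap

variable {g : ℂ → ℂ} {t : ℝ}

theorem mapsTo_closedBall (hg : IsNormalizedSelfMap g t) :
    MapsTo g (ball 0 1) (closedBall (g 0) 1) := by
  rw [hg.map_zero]
  exact hg.mapsTo.mono_right ball_subset_closedBall

theorem abs_le_one (hg : IsNormalizedSelfMap g t) : |t| ≤ 1 := by
  have h := Complex.norm_deriv_le_one_of_mapsTo_ball hg.differentiableOn hg.mapsTo_closedBall
    one_pos
  simpa [hg.deriv_zero] using h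

theorem norm_le (hg : IsNormalizedSelfMap g t) {z : ℂ} (hz : ‖z‖ < 1) : ‖g z‖ ≤ ‖z‖ := by
  have h := Complex.dist_le_dist_of_mapsTo_ball hg.differentiableOn hg.mapsTo_closedBall
    (mem_ball_zero_iff.2 hz)
  simpa [hg.map_zero] using h

/-- By Schwarz, g(z)/z has modulus at most 1, so g(z)/z − t has real part at most ε and vanishes at
0; Borel–Carathéodory then bounds its modulus. Of the 3ε, two come from there and one from |t − 1|.
-/
theorem norm_sub_self_le (hg : IsNormalizedSelfMap g t) {ε ρ : ℝ} (ht : 1 - ε < t) (hρ : ρ < 1)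
    {z : ℂ} (hz : ‖z‖ ≤ ρ) : ‖g z - z‖ ≤ 3 * ε / (1 - ρ) := by
  have hρ0 : 0 ≤ ρ := (norm_nonneg z).trans hz
  have ht1 : t ≤ 1 := (le_abs_self t).trans hg.abs_le_one
  have hε : 0 < ε := by linarith
  have hz1 : z ∈ ball (0 : ℂ) 1 := mem_ball_zero_iff.2 (hz.trans_lt hρ)
  have hball : ball (0 : ℂ) 1 ∈ 𝓝 (0 : ℂ) := ball_mem_nhds 0 one_pos
  have hd : DifferentiableOn ℂ (fun w => dslope g 0 w - t) (ball 0 1) :=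
    ((Complex.differentiableOn_dslope hball).2 hg.differentiableOn).sub_const _
  have hre : MapsTo (fun w => dslope g 0 w - t) (ball 0 1) {w | w.re ≤ ε} := by
    intro w hw
    have h := Complex.norm_dslope_le_div_of_mapsTo_ball hg.differentiableOn hg.mapsTo_closedBall hw
    have h2 := Complex.re_le_norm (dslope g 0 w)
    simp only [mem_ofPred_eq, Complex.sub_re, Complex.ofReal_re]
    linarith
  have h0 : (fun w => dslope g 0 w - (t : ℂ)) 0 = 0 := by simp [hg.deriv_zero]
  have h := Complex.borelCaratheodory_zero hε hd hre one_pos hz1 h0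
  have hgz : g z = z * dslope g 0 z := by
    have := sub_smul_dslope g 0 z
    simpa [hg.map_zero] using this.symm
  have h1 : ‖dslope g 0 z - t‖ ≤ 2 * ε * 1 / (1 - ρ) := by
    refine h.trans ?_
    have : 0 < 1 - ρ := by linarith
    gcongr
    linarith
  have h2 : ‖(t : ℂ) - 1‖ ≤ ε := by
    have : (t : ℂ) - 1 = ((t - 1 : ℝ) : ℂ) := by push_cast; rfl
    rw [this, Complex.norm_real, Real.norm_eq_abs, abs_le]
    constructor <;> linarith
  have h3 : ε ≤ ε / (1 - ρ) := by
    rw [le_div_iff₀ (by linarith)]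
    nlinarith
  calc ‖g z - z‖ = ‖z‖ * ‖(dslope g 0 z - t) + (t - 1)‖ := by
        rw [hgz, ← norm_mul]; congr 1; ring
    _ ≤ 1 * (2 * ε * 1 / (1 - ρ) + ε) := by
        gcongr
        · linarith
        · exact (norm_add_le _ _).trans (add_le_add h1 h2)
    _ ≤ 3 * ε / (1 - ρ) := by
        have : 3 * ε / (1 - ρ) = 2 * ε * 1 / (1 - ρ) + ε / (1 - ρ) := by ring
        rw [this]
        linarith

/-- Cauchy's estimate for the derivative of g − id on circles of radius (1 − ρ)/2, then the mean
value inequality. Both the radius and the remaining distance to the unit circle cost a factor 2,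
hence 12 = 3 · 2 · 2. -/
theorem norm_sub_sub_sub_le (hg : IsNormalizedSelfMap g t) {ε ρ : ℝ} (ht : 1 - ε < t) (hρ : ρ < 1)
    {z w : ℂ} (hz : ‖z‖ ≤ ρ) (hw : ‖w‖ ≤ ρ) :
    ‖g z - g w - (z - w)‖ ≤ 12 * ε / (1 - ρ) ^ 2 * ‖z - w‖ := by
  have hdiff : DifferentiableOn ℂ (fun u => g u - u) (ball 0 1) :=
    hg.differentiableOn.sub differentiableOn_id
  have hsub : closedBall (0 : ℂ) ρ ⊆ ball 0 1 := closedBall_subset_ball hρ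
  have key := (convex_closedBall (0 : ℂ) ρ).norm_image_sub_le_of_norm_deriv_le
    (f := fun u => g u - u) (C := 12 * ε / (1 - ρ) ^ 2) (x := w) (y := z)
    (fun u hu => hdiff.differentiableAt (isOpen_ball.mem_nhds (hsub hu))) ?_
    (by simpa using hw) (by simpa using hz)
  · refine le_of_eq_of_le ?_ key
    congr 1
    ring
  intro u hu
  have hu' : ‖u‖ ≤ ρ := by simpa using hu
  have hR : 0 < (1 - ρ) / 2 := by linarith
  have hcl : closedBall u ((1 - ρ) / 2) ⊆ closedBall 0 ((1 + ρ) / 2) := by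
    intro x hx
    rw [mem_closedBall, dist_eq_norm] at hx
    rw [mem_closedBall_zero_iff]
    have := norm_le_norm_add_norm_sub' x u
    linarith
  have h := Complex.norm_deriv_le_of_forall_mem_sphere_norm_le (c := u) (R := (1 - ρ) / 2)
    (C := 3 * ε / (1 - (1 + ρ) / 2)) (f := fun u => g u - u) hR ?_ ?_
  · refine h.trans (le_of_eq ?_)
    have : 1 - ρ ≠ 0 := by linarith
    have h' : 1 - (1 + ρ) / 2 = (1 - ρ) / 2 := by ring
    rw [h']
    field_simp
    ring
  · refine (hdiff.mono ?_).diffContOnCl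
    rw [closure_ball _ hR.ne']
    exact hcl.trans (closedBall_subset_ball (by linarith))
  · intro x hx
    exact hg.norm_sub_self_le ht (by linarith)
      (by simpa using hcl (sphere_subset_closedBall hx))

end IsNormalizedSelfMap

/-- Two maps `A`, `B` that agree at `0` but have different derivatives there produce a stable
solution of the system `ζ = A ζ'`, `ζ = B ζ'`: it survives when the identity is replaced by self-maps
of the disk that are almost extremal for the Schwarz lemma. -/
theorem exists_common_solution_of_deriv_ne {A B : ℂ → ℂ} {a b c : ℂ} (hc : ‖c‖ < 1)
    (hA0 : A 0 = c) (hB0 : B 0 = c) (hA : HasStrictDerivAt A a 0) (hB : HasStrictDerivAt B b 0)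
    (hab : a ≠ b) :
    ∃ ε > 0, ∀ (g k : ℂ → ℂ) (t : ℝ), IsNormalizedSelfMap g t → IsNormalizedSelfMap k t →
      1 - ε < t → ∃ ζ ∈ ball (0 : ℂ) 1, ∃ ζ' ∈ ball (0 : ℂ) 1,
        g ζ = A (g ζ') ∧ k ζ = B (k ζ') := by
  -- Linearization at (c, 0) of the unperturbed system (ζ − A ζ', ζ − B ζ'); its determinant is a −
  -- b up to sign.
  let L : ℂ × ℂ →L[ℂ] ℂ × ℂ :=
    (ContinuousLinearMap.fst ℂ ℂ ℂ - a • ContinuousLinearMap.snd ℂ ℂ ℂ).prod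
      (ContinuousLinearMap.fst ℂ ℂ ℂ - b • ContinuousLinearMap.snd ℂ ℂ ℂ)
  have hL : ∀ p : ℂ × ℂ, L p = (p.1 - a * p.2, p.1 - b * p.2) := fun p => rfl
  have hsurj : L.range = ⊤ := by
    rw [LinearMap.range_eq_top]
    rintro ⟨u, v⟩
    refine ⟨(u + a * ((u - v) / (b - a)), (u - v) / (b - a)), ?_⟩
    change L _ = _
    have : b - a ≠ 0 := sub_ne_zero.2 hab.symm
    rw [hL]
    ext
    · simp
    · simp only
      field_simp
      ring
  let S := L.nonlinearRightInverseOfSurjective hsurj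
  have hS : 0 < (S.nnnorm : ℝ) := L.nonlinearRightInverseOfSurjective_nnnorm_pos hsurj
  -- A map within C of `L` on the ball of radius r covers a ball of radius (‖S‖⁻¹ − C) r = C r about
  -- its central value.
  obtain ⟨C, hC, hCS⟩ : ∃ C : ℝ, 0 < C ∧ (S.nnnorm : ℝ)⁻¹ - C = C :=
    ⟨(S.nnnorm : ℝ)⁻¹ / 2, by positivity, by ring⟩
  have strict : ∀ {D : ℂ → ℂ} {d : ℂ}, HasStrictDerivAt D d 0 → ∃ δ > 0, ∀ x y : ℂ, ‖x‖ < δ →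
      ‖y‖ < δ → ‖D x - D y - d * (x - y)‖ ≤ C / 4 * ‖x - y‖ := by
    intro D d hD
    have h := hD.hasStrictFDerivAt.isLittleO.def (c := C / 4) (by positivity)
    rw [nhds_prod_eq, ← nhds_prod_eq, Metric.eventually_nhds_iff_ball] at h
    obtain ⟨δ, hδ, h⟩ := h
    refine ⟨δ, hδ, fun x y hx hy => ?_⟩
    have := h (x, y) (by simpa [Prod.dist_eq] using ⟨hx, hy⟩)
    simpa [mul_comm] using this
  obtain ⟨δ₁, hδ₁, hA'⟩ := strict hA
  obtain ⟨δ₂, hδ₂, hB'⟩ := strict hB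
  set ρ := (1 + ‖c‖) / 2 with hρ
  have hρ1 : ρ < 1 := by linarith
  obtain ⟨r, hr, hr1, hr2, hr3⟩ : ∃ r : ℝ, 0 < r ∧ r ≤ (1 - ‖c‖) / 2 ∧ r < δ₁ ∧ r < δ₂ := by
    refine ⟨min ((1 - ‖c‖) / 2) (min (δ₁ / 2) (δ₂ / 2)), ?_, min_le_left _ _, ?_, ?_⟩
    · refine lt_min (by linarith) (lt_min ?_ ?_) <;> linarith
    · refine lt_of_le_of_lt ((min_le_right _ _).trans (min_le_left _ _)) (by linarith)
    · refine lt_of_le_of_lt ((min_le_right _ _).trans (min_le_right _ _)) (by linarith)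
  -- Error budget: half of C goes to replacing the identity by g or k, the other half to linearizing
  -- A or B (C/4 times the Lipschitz constant 1 + η ≤ 2). The last bound keeps the central value
  -- within C r of the origin.
  obtain ⟨η, hη, hη1, hη2, hη3, hη4⟩ : ∃ η : ℝ, 0 < η ∧ η ≤ 1 ∧ η * (1 + ‖a‖) ≤ C / 2 ∧
      η * (1 + ‖b‖) ≤ C / 2 ∧ η ≤ C * r := by
    refine ⟨min 1 (min (C / 2 / (1 + ‖a‖)) (min (C / 2 / (1 + ‖b‖)) (C * r))), ?_,
      min_le_left _ _, ?_, ?_, ?_⟩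
    · positivity
    · rw [← le_div_iff₀ (by positivity)]
      exact (min_le_right _ _).trans (min_le_left _ _)
    · rw [← le_div_iff₀ (by positivity)]
      exact (min_le_right _ _).trans ((min_le_right _ _).trans (min_le_left _ _))
    · exact (min_le_right _ _).trans ((min_le_right _ _).trans (min_le_right _ _))
  have hρ0 : 0 < 1 - ρ := by linarith
  refine ⟨η * (1 - ρ) ^ 2 / 12, by positivity, fun g k t hg hk ht => ?_⟩
  have lip : ∀ {f : ℂ → ℂ}, IsNormalizedSelfMap f t → ∀ {z w : ℂ}, ‖z‖ ≤ ρ → ‖w‖ ≤ ρ →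
      ‖f z - f w - (z - w)‖ ≤ η * ‖z - w‖ := by
    intro f hf z w hz hw
    refine (hf.norm_sub_sub_sub_le ht hρ1 hz hw).trans (le_of_eq ?_)
    field_simp
  have row : ∀ {f D : ℂ → ℂ} {d : ℂ} {δ : ℝ}, IsNormalizedSelfMap f t → r < δ →
      (∀ x y : ℂ, ‖x‖ < δ → ‖y‖ < δ → ‖D x - D y - d * (x - y)‖ ≤ C / 4 * ‖x - y‖) →
      η * (1 + ‖d‖) ≤ C / 2 → ∀ p ∈ closedBall (c, (0 : ℂ)) r, ∀ q ∈ closedBall (c, (0 : ℂ)) r,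
      ‖(f p.1 - D (f p.2)) - (f q.1 - D (f q.2)) - ((p - q).1 - d * (p - q).2)‖
        ≤ C * ‖p - q‖ := by
    intro f D d δ hf hrδ hD hηd p hp q hq
    have bd : ∀ p ∈ closedBall (c, (0 : ℂ)) r, ‖p.1‖ ≤ ρ ∧ ‖p.2‖ ≤ ρ ∧ ‖f p.2‖ < δ := by
      intro p hp
      rw [← closedBall_prod_same] at hp
      have h1 : ‖p.1 - c‖ ≤ r := by simpa [dist_eq_norm] using hp.1
      have h2 : ‖p.2‖ ≤ r := by simpa using hp.2
      have h3 := norm_le_norm_add_norm_sub' p.1 c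
      have h4 := norm_nonneg c
      refine ⟨by linarith, by linarith, ?_⟩
      exact (hf.norm_le (by linarith)).trans_lt (by linarith)
    obtain ⟨hp1, hp2, hp3⟩ := bd p hp
    obtain ⟨hq1, hq2, hq3⟩ := bd q hq
    have e1 := lip hf hp1 hq1
    have e2 := lip hf hp2 hq2
    have e3 := hD _ _ hp3 hq3
    have n1 : ‖p.1 - q.1‖ ≤ ‖p - q‖ := norm_fst_le (p - q)
    have n2 : ‖p.2 - q.2‖ ≤ ‖p - q‖ := norm_snd_le (p - q)
    have e4 : ‖f p.2 - f q.2‖ ≤ (1 + η) * ‖p.2 - q.2‖ := by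
      have := norm_le_norm_add_norm_sub' (f p.2 - f q.2) (p.2 - q.2)
      linarith
    have split : (f p.1 - D (f p.2)) - (f q.1 - D (f q.2)) - ((p - q).1 - d * (p - q).2) =
        (f p.1 - f q.1 - (p.1 - q.1)) - (D (f p.2) - D (f q.2) - d * (f p.2 - f q.2))
          - d * (f p.2 - f q.2 - (p.2 - q.2)) := by
      simp only [Prod.fst_sub, Prod.snd_sub]
      ring
    rw [split]
    calc _ ≤ ‖f p.1 - f q.1 - (p.1 - q.1)‖ + ‖D (f p.2) - D (f q.2) - d * (f p.2 - f q.2)‖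
          + ‖d‖ * ‖f p.2 - f q.2 - (p.2 - q.2)‖ := by
          rw [← norm_mul]
          exact (norm_sub_le _ _).trans (add_le_add_left (norm_sub_le _ _) _)
      _ ≤ η * ‖p - q‖ + C / 4 * ((1 + 1) * ‖p - q‖) + ‖d‖ * (η * ‖p - q‖) := by
          gcongr
          · exact e1.trans (by gcongr)
          · refine e3.trans ?_
            gcongr
            exact e4.trans (by gcongr)
          · exact e2.trans (by gcongr)
      _ = (η * (1 + ‖d‖) + C / 2) * ‖p - q‖ := by ring
      _ ≤ C * ‖p - q‖ := by
          gcongr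
          linarith
  have happ : ApproximatesLinearOn (fun p : ℂ × ℂ => (g p.1 - A (g p.2), k p.1 - B (k p.2))) L
      (closedBall (c, 0) r) C.toNNReal := by
    intro p hp q hq
    rw [hL, Real.coe_toNNReal _ hC.le]
    refine max_le ?_ ?_
    · exact row hg hr2 hA' hη2 p hp q hq
    · exact row hk hr3 hB' hη3 p hp q hq
  have hs := happ.surjOn_closedBall_of_nonlinearRightInverse S hr.le Subset.rfl
  have small : ∀ {f : ℂ → ℂ}, IsNormalizedSelfMap f t → ‖f c - c‖ ≤ C * r := by
    intro f hf
    have := lip hf (z := c) (w := 0) (by linarith) (by simpa using by positivity)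
    rw [hf.map_zero, sub_zero, sub_zero] at this
    exact this.trans (by nlinarith)
  obtain ⟨p, hp, hp'⟩ := hs (a := (0, 0)) (by
    rw [Real.coe_toNNReal _ hC.le, hCS]
    simp only [hg.map_zero, hk.map_zero, hA0, hB0]
    rw [mem_closedBall', dist_eq_norm, Prod.norm_def]
    simpa using ⟨small hg, small hk⟩)
  rw [← closedBall_prod_same] at hp
  have h1 : ‖p.1 - c‖ ≤ r := by simpa [dist_eq_norm] using hp.1
  have h2 : ‖p.2‖ ≤ r := by simpa using hp.2
  have h3 := norm_le_norm_add_norm_sub' p.1 c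
  refine ⟨p.1, by simpa using by linarith, p.2, by simpa using by linarith [norm_nonneg c], ?_⟩
  simp only [Prod.mk.injEq] at hp'
  exact ⟨sub_eq_zero.1 hp'.1, sub_eq_zero.1 hp'.2⟩

end NearlyExtremal

/-! ### Holomorphic self-maps of the disk as functions on `ℂ` -/

namespace Disk

open Metric Set

theorem norm_lt_one (z : Disk) : ‖(z : ℂ)‖ < 1 := mem_ball_zero_iff.1 z.2

@[simp] theorem coe_zero : ((0 : Disk) : ℂ) = 0 := rfl

open Classical in
/-- The retraction of `ℂ` onto the unit disk that sends everything outside to `0`. -/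
noncomputable def ofComplex (z : ℂ) : Disk := if h : z ∈ ball (0 : ℂ) 1 then ⟨z, h⟩ else 0

theorem coe_ofComplex {z : ℂ} (h : z ∈ ball (0 : ℂ) 1) : (ofComplex z : ℂ) = z := by
  rw [ofComplex, dif_pos h]

@[simp] theorem ofComplex_coe (z : Disk) : ofComplex z = z :=
  Subtype.ext (coe_ofComplex z.2)

theorem contMDiffAt_iff_coe {E : Type*} [NormedAddCommGroup E] [NormedSpace ℂ E]
    {H : Type*} [TopologicalSpace H] {I : ModelWithCorners ℂ E H} {M : Type*} [TopologicalSpace M]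
    [ChartedSpace H M] (f : M → Disk) (x : M) :
    ContMDiffAt I 𝓘(ℂ) ω (fun y => (f y : ℂ)) x ↔ ContMDiffAt I 𝓘(ℂ) ω f x :=
  ChartedSpace.liftPropWithinAt_subtypeVal_comp_iff f _ _

theorem contMDiffAt_ofComplex {z : ℂ} (h : z ∈ ball (0 : ℂ) 1) :
    ContMDiffAt 𝓘(ℂ) 𝓘(ℂ) ω ofComplex z := by
  rw [← contMDiffAt_iff_coe]
  refine contMDiffAt_id.congr_of_eventuallyEq ?_
  filter_upwards [isOpen_ball.mem_nhds h] with w hw using coe_ofComplex hw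

/-- A holomorphic self-map of the disk as a function on `ℂ`. -/
noncomputable def extend (G : Disk → Disk) (z : ℂ) : ℂ := G (ofComplex z)

@[simp] theorem extend_coe (G : Disk → Disk) (z : Disk) : extend G z = G z := by
  rw [extend, ofComplex_coe]

theorem mapsTo_extend (G : Disk → Disk) : MapsTo (extend G) (ball 0 1) (ball 0 1) :=
  fun _ _ => (G _).2

theorem contMDiffAt_extend {G : Disk → Disk} (hG : ContMDiff 𝓘(ℂ) 𝓘(ℂ) ω G) {z : ℂ}
    (hz : z ∈ ball (0 : ℂ) 1) : ContMDiffAt 𝓘(ℂ) 𝓘(ℂ) ω (extend G) z :=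
  ((contMDiffAt_iff_coe G _).2 (hG _)).comp z (contMDiffAt_ofComplex hz)

theorem differentiableOn_extend {G : Disk → Disk} (hG : ContMDiff 𝓘(ℂ) 𝓘(ℂ) ω G) :
    DifferentiableOn ℂ (extend G) (ball 0 1) := fun _ hz =>
  ((contMDiffAt_extend hG hz).contDiffAt.differentiableAt (by simp)).differentiableWithinAt

theorem contMDiff_of_differentiableOn {G : Disk → Disk} {f : ℂ → ℂ}
    (hf : DifferentiableOn ℂ f (ball 0 1)) (hG : ∀ z : Disk, (G z : ℂ) = f z) :
    ContMDiff 𝓘(ℂ) 𝓘(ℂ) ω G := by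
  intro z
  rw [← contMDiffAt_iff_coe]
  simp_rw [hG]
  exact ((hf.analyticAt (isOpen_ball.mem_nhds z.2)).contDiffAt.contMDiffAt).comp z
    (contMDiff_subtype_val z)

/-- The derivative at `0` of a self-map of the disk that fixes `0`, computed in the manifold `△`. -/
theorem deriv_extend_zero {G : Disk → Disk} (hG : ContMDiff 𝓘(ℂ) 𝓘(ℂ) ω G) (h0 : G 0 = 0) {t : ℂ}
    (ht : (mfderiv 𝓘(ℂ) 𝓘(ℂ) G 0 (1 : ℂ) : ℂ) = t) : deriv (extend G) 0 = t := by
  have hmem : (0 : ℂ) ∈ ball (0 : ℂ) 1 := mem_ball_self one_pos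
  have hval : MDifferentiableAt 𝓘(ℂ) 𝓘(ℂ) (Subtype.val : Disk → ℂ) 0 :=
    (contMDiff_subtype_val (n := ω) 0).mdifferentiableAt (by simp)
  have hofC : MDifferentiableAt 𝓘(ℂ) 𝓘(ℂ) ofComplex ((0 : Disk) : ℂ) :=
    (contMDiffAt_ofComplex hmem).mdifferentiableAt (by simp)
  have hext : MDifferentiableAt 𝓘(ℂ) 𝓘(ℂ) (extend G) ((0 : Disk) : ℂ) :=
    (contMDiffAt_extend hG hmem).mdifferentiableAt (by simp)
  have hGd : MDifferentiableAt 𝓘(ℂ) 𝓘(ℂ) G 0 := (hG 0).mdifferentiableAt (by simp)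
  let V : ℂ →L[ℂ] ℂ := mfderiv 𝓘(ℂ) 𝓘(ℂ) (Subtype.val : Disk → ℂ) 0
  let W : ℂ →L[ℂ] ℂ := mfderiv 𝓘(ℂ) 𝓘(ℂ) ofComplex ((0 : Disk) : ℂ)
  -- The derivative V of the inclusion is never computed: being invertible, it cancels from the
  -- chain rule for the inclusion after G and `extend G` after the inclusion.
  have hWV : W (V 1) = 1 := by
    have h1 := mfderiv_comp (0 : Disk) hofC hval
    have h2 : ofComplex ∘ (Subtype.val : Disk → ℂ) = id := funext ofComplex_coe
    rw [h2, mfderiv_id] at h1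
    exact (DFunLike.congr_fun h1 (1 : ℂ)).symm
  have hV : V 1 ≠ 0 := by
    intro h
    rw [h, map_zero] at hWV
    exact zero_ne_one hWV
  have hval' : MDifferentiableAt 𝓘(ℂ) 𝓘(ℂ) (Subtype.val : Disk → ℂ) (G 0) := by rwa [h0]
  have e1 := mfderiv_comp (0 : Disk) hval' hGd
  have e2 := mfderiv_comp (0 : Disk) hext hval
  have e3 : (Subtype.val : Disk → ℂ) ∘ G = extend G ∘ (Subtype.val : Disk → ℂ) :=
    funext fun z => (extend_coe G z).symm
  rw [e3, e2, h0] at e1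
  have e4 : (fderiv ℂ (extend G) 0) (V 1) = V (mfderiv 𝓘(ℂ) 𝓘(ℂ) G 0 (1 : ℂ)) := by
    rw [← mfderiv_eq_fderiv]
    exact DFunLike.congr_fun e1 (1 : ℂ)
  have e5 : V t = t * V 1 := by
    have := V.map_smul t 1
    simpa using this
  have e6 : (fderiv ℂ (extend G) 0) (V 1) = V 1 * deriv (extend G) 0 := by
    simp
  have e7 : V 1 * deriv (extend G) 0 = V 1 * t := by
    rw [← e6, e4, mul_comm, ← e5]
    exact congrArg V ht
  exact mul_left_cancel₀ hV e7

/-- Together with local path connectedness, this lets discs lift through a covering. -/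
instance : SimplyConnectedSpace Disk := by
  have : ContractibleSpace (ball (0 : ℂ) 1) :=
    (convex_ball (0 : ℂ) 1).contractibleSpace ⟨0, mem_ball_self one_pos⟩
  exact inferInstanceAs (SimplyConnectedSpace (ball (0 : ℂ) 1))

instance : LocallyPathConnectedSpace Disk :=
  (isOpen_ball (x := (0 : ℂ)) (ε := 1)).locallyPathConnectedSpace

end Disk

/-! ### The projection onto the quotient manifold -/

namespace AutHol.Quotient

variable {E : Type*} [NormedAddCommGroup E] [NormedSpace ℂ E]
  {H : Type*} [TopologicalSpace H] {I : ModelWithCorners ℂ E H}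
  {M : Type*} [TopologicalSpace M] [ChartedSpace H M]

theorem mk_smul (Γ : Subgroup (AutHol I M)) {φ : AutHol I M} (hφ : φ ∈ Γ) (m : M) :
    mk Γ (φ • m) = mk Γ m :=
  (mk_eq_iff Γ).2 ⟨φ, hφ, rfl⟩

variable [IsManifold I ω M] (Γ : Subgroup (AutHol I M)) [AutHol.IsKleinian Γ]

/-- The projection is holomorphic, with holomorphic local left inverses. -/
theorem contMDiffAt_mk_and_exists_leftInverse (m : M) :
    ContMDiffAt I I ω (mk Γ) m ∧ ∃ σ : AutHol.Quotient Γ → M, ContMDiffAt I I ω σ (mk Γ m) ∧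
      ∀ᶠ z in 𝓝 m, σ (mk Γ z) = z := by
  have hπ := isLocalHomeomorph_mk Γ
  set q := mk Γ m with hq
  set p := (mk_surjective Γ).hasRightInverse.choose q with hp
  have hpq : mk Γ p = q := (mk_surjective Γ).hasRightInverse.choose_spec q
  set s := hπ.localInverseAt p with hs
  have hchart : chartAt H q = s.trans (chartAt H p) := rfl
  have hs_symm : (s.symm : M → AutHol.Quotient Γ) = mk Γ := hπ.localInverseAt_symm p
  have hps : p ∈ s.target := hπ.self_mem_localInverseAt_target
  have hsp : s q = p := by rw [← hpq]; exact hπ.localInverseAt_apply_self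
  -- The chart at q is built from the representative p, so smoothness is immediate at p; φ carries m
  -- to p and transports it.
  obtain ⟨φ, hφ, hφm⟩ := (mk_eq_iff Γ).1 hpq
  have hφc : ContMDiff I I ω (fun z : M => φ • z) := φ.2.1
  have hφs : ContMDiff I I ω (fun z : M => φ⁻¹ • z) := φ.2.2
  have hqs : q ∈ s.source := by rw [← hpq]; exact hπ.apply_self_mem_localInverseAt_source
  have hmk : ∀ᶠ z in 𝓝 p, (chartAt H q).symm (chartAt H p z) = mk Γ z := by
    filter_upwards [(chartAt H p).open_source.mem_nhds (mem_chart_source H p)] with z hz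
    rw [hchart, OpenPartialHomeomorph.trans_symm_eq_symm_trans_symm,
      OpenPartialHomeomorph.coe_trans, Function.comp_apply, hs_symm, (chartAt H p).left_inv hz]
  have hsec : ∀ᶠ x in 𝓝 q, (chartAt H p).symm (chartAt H q x) = s x := by
    filter_upwards [(chartAt H q).open_source.mem_nhds (mem_chart_source H q)] with x hx
    rw [hchart, OpenPartialHomeomorph.trans_source] at hx
    rw [hchart, OpenPartialHomeomorph.coe_trans, Function.comp_apply,
      (chartAt H p).left_inv hx.2]
  have hqp : chartAt H q q = chartAt H p p := by
    rw [hchart, OpenPartialHomeomorph.coe_trans, Function.comp_apply, hsp]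
  have mk_p : ContMDiffAt I I ω (mk Γ) p := by
    refine ContMDiffAt.congr_of_eventuallyEq ?_ (hmk.mono fun _ h => h.symm)
    refine ContMDiffAt.comp p (I' := I) (g := (chartAt H q).symm) ?_ (contMDiffAt_of_mem_maximalAtlas
      (IsManifold.chart_mem_maximalAtlas p) (mem_chart_source H p))
    refine contMDiffOn_chart_symm.contMDiffAt ((chartAt H q).open_target.mem_nhds ?_)
    rw [← hqp]
    exact mem_chart_target H q
  have s_q : ContMDiffAt I I ω s q := by
    refine ContMDiffAt.congr_of_eventuallyEq ?_ (hsec.mono fun _ h => h.symm)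
    refine ContMDiffAt.comp q (I' := I) (g := (chartAt H p).symm) ?_ (contMDiffAt_of_mem_maximalAtlas
      (IsManifold.chart_mem_maximalAtlas q) (mem_chart_source H q))
    refine contMDiffOn_chart_symm.contMDiffAt ((chartAt H p).open_target.mem_nhds ?_)
    rw [hqp]
    exact mem_chart_target H p
  have hφm' : φ • m = p := hφm
  refine ⟨?_, fun x => φ⁻¹ • s x, (hφs _).comp q s_q, ?_⟩
  · have : mk Γ = fun z => mk Γ (φ • z) := funext fun z => (mk_smul Γ hφ z).symm
    rw [this]
    refine ContMDiffAt.comp m (I' := I) (g := mk Γ) ?_ (hφc m)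
    rw [hφm']
    exact mk_p
  · have hev : ∀ᶠ z in 𝓝 m, φ • z ∈ s.target :=
      hφc.continuous.continuousAt.eventually (s.open_target.mem_nhds (by simpa only [hφm'] using hps))
    filter_upwards [hev] with z hz
    have h1 : s (mk Γ (φ • z)) = φ • z := by
      rw [← hs_symm]
      exact s.right_inv hz
    rw [mk_smul Γ hφ] at h1
    rw [h1, inv_smul_smul]

theorem contMDiff_mk : ContMDiff I I ω (mk Γ) := fun m =>
  (contMDiffAt_mk_and_exists_leftInverse Γ m).1

theorem injective_mfderiv_mk (m : M) : Function.Injective (mfderiv I I (mk Γ) m) := by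
  obtain ⟨hm, σ, hσ, hleft⟩ := contMDiffAt_mk_and_exists_leftInverse Γ m
  have h := mfderiv_comp m (hσ.mdifferentiableAt (by simp)) (hm.mdifferentiableAt (by simp))
  have h' : σ ∘ mk Γ =ᶠ[𝓝 m] id := hleft
  rw [h'.mfderiv_eq, mfderiv_id] at h
  intro u v huv
  have hu := DFunLike.congr_fun h u
  have hv := DFunLike.congr_fun h v
  exact hu.trans ((congrArg (mfderiv I I σ (mk Γ m)) huv).trans hv.symm)

/-- Holomorphic maps from the disk lift through the projection. -/
theorem exists_contMDiff_lift {f : Disk → AutHol.Quotient Γ} (hf : ContMDiff 𝓘(ℂ) I ω f) {m : M}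
    (hm : mk Γ m = f 0) :
    ∃ F : Disk → M, ContMDiff 𝓘(ℂ) I ω F ∧ F 0 = m ∧ ∀ z, mk Γ (F z) = f z := by
  obtain ⟨F, ⟨hF0, hF⟩, -⟩ := (isQuotientCoveringMap_mk Γ).isCoveringMap.existsUnique_continuousMap_lifts
    ⟨f, hf.continuous⟩ 0 m hm
  have hF' : ∀ z, mk Γ (F z) = f z := congrFun hF
  refine ⟨F, fun z => ?_, hF0, hF'⟩
  -- Near z the continuous lift is σ ∘ f, hence holomorphic.
  obtain ⟨-, σ, hσ, hleft⟩ := contMDiffAt_mk_and_exists_leftInverse Γ (F z)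
  rw [hF'] at hσ
  refine (hσ.comp z (hf z)).congr_of_eventuallyEq ?_
  filter_upwards [F.continuous.continuousAt.eventually hleft] with w hw
  rw [Function.comp_apply, ← hF', hw]

end AutHol.Quotient

/-! ### Möbius transformations of the disk -/

section Mobius

open Metric Set
open scoped ComplexConjugate

/-- The automorphism `φ` of the disk is `z ↦ (α z + β) / (conj β z + conj α)`. -/
structure IsMobius (φ : AutHol 𝓘(ℂ) Disk) (α β : ℂ) : Prop where
  normSq_lt : Complex.normSq β < Complex.normSq α
  smul_mul : ∀ z : Disk, ((φ • z : Disk) : ℂ) * (conj β * z + conj α) = α * z + β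

theorem Disk.normSq_lt_one (z : Disk) : Complex.normSq (z : ℂ) < 1 := by
  rw [Complex.normSq_eq_norm_sq]
  have := z.norm_lt_one
  have := norm_nonneg (z : ℂ)
  nlinarith

/-- The matrix (α, β; conj β, conj α) scales the Hermitian form |z₁|² − |z₂|² by its determinant. -/
theorem normSq_denom_sub_normSq_num (α β z : ℂ) :
    Complex.normSq (conj β * z + conj α) - Complex.normSq (α * z + β) =
      (Complex.normSq α - Complex.normSq β) * (1 - Complex.normSq z) := by
  simp only [Complex.normSq_apply, Complex.add_re, Complex.add_im, Complex.mul_re, Complex.mul_im,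
    Complex.conj_re, Complex.conj_im]
  ring

theorem normSq_num_lt_normSq_denom {α β : ℂ} (h : Complex.normSq β < Complex.normSq α) {z : ℂ}
    (hz : z ∈ ball (0 : ℂ) 1) :
    Complex.normSq (α * z + β) < Complex.normSq (conj β * z + conj α) := by
  have h1 := normSq_denom_sub_normSq_num α β z
  have h2 := Disk.normSq_lt_one ⟨z, hz⟩
  have h3 := mul_pos (sub_pos.2 h) (sub_pos.2 h2)
  simp only at h3
  linarith

theorem mobius_denom_ne_zero {α β : ℂ} (h : Complex.normSq β < Complex.normSq α) {z : ℂ}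
    (hz : z ∈ ball (0 : ℂ) 1) : conj β * z + conj α ≠ 0 := by
  intro h0
  have h1 := normSq_num_lt_normSq_denom h hz
  rw [h0, Complex.normSq_zero] at h1
  exact absurd (Complex.normSq_nonneg _) (not_le.2 h1)

/-- The map `z ↦ (α z + β) / (conj β z + conj α)` of the disk into itself. -/
noncomputable def mobiusMap (α β : ℂ) (h : Complex.normSq β < Complex.normSq α) (z : Disk) : Disk :=
  ⟨(α * z + β) / (conj β * z + conj α), by
    have h1 := normSq_num_lt_normSq_denom h z.2
    have h2 := (Complex.normSq_nonneg _).trans_lt h1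
    change _ ∈ ball (0 : ℂ) 1
    rw [mem_ball_zero_iff, ← sq_lt_one_iff₀ (norm_nonneg _), ← Complex.normSq_eq_norm_sq,
      Complex.normSq_div, div_lt_one h2]
    exact h1⟩

theorem mobiusMap_mul {α β : ℂ} (h : Complex.normSq β < Complex.normSq α) (z : Disk) :
    (mobiusMap α β h z : ℂ) * (conj β * z + conj α) = α * z + β :=
  div_mul_cancel₀ _ (mobius_denom_ne_zero h z.2)

theorem differentiableOn_mobius {α β : ℂ} (h : Complex.normSq β < Complex.normSq α) :
    DifferentiableOn ℂ (fun z : ℂ => (α * z + β) / (conj β * z + conj α)) (ball 0 1) := by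
  refine DifferentiableOn.div (by fun_prop) (by fun_prop) fun z hz => mobius_denom_ne_zero h hz

theorem contMDiff_mobiusMap {α β : ℂ} (h : Complex.normSq β < Complex.normSq α) :
    ContMDiff 𝓘(ℂ) 𝓘(ℂ) ω (mobiusMap α β h) :=
  Disk.contMDiff_of_differentiableOn (differentiableOn_mobius h) fun _ => rfl

theorem mobiusMap_leftInverse {α β : ℂ} (h : Complex.normSq β < Complex.normSq α)
    (h' : Complex.normSq (-β) < Complex.normSq (conj α)) :
    Function.LeftInverse (mobiusMap (conj α) (-β) h') (mobiusMap α β h) := by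
  intro z
  have e1 := mobiusMap_mul h z
  have e2 := mobiusMap_mul h' (mobiusMap α β h z)
  set w := mobiusMap α β h z
  have hd := mobius_denom_ne_zero h' w.2
  simp only [map_neg, Complex.conj_conj] at e2 hd
  refine Subtype.ext (mul_right_cancel₀ hd (e2.trans ?_))
  linear_combination e1

theorem exists_isMobius {α β : ℂ} (h : Complex.normSq β < Complex.normSq α) :
    ∃ φ : AutHol 𝓘(ℂ) Disk, IsMobius φ α β := by
  have h' : Complex.normSq (-β) < Complex.normSq (conj α) := by simpa using h
  have hr : Function.RightInverse (mobiusMap (conj α) (-β) h') (mobiusMap α β h) := by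
    intro z
    have e1 := mobiusMap_mul h' z
    have e2 := mobiusMap_mul h (mobiusMap (conj α) (-β) h' z)
    set w := mobiusMap (conj α) (-β) h' z
    simp only [map_neg, Complex.conj_conj] at e1
    refine Subtype.ext (mul_right_cancel₀ (mobius_denom_ne_zero h w.2) (e2.trans ?_))
    linear_combination e1
  exact ⟨⟨{ toFun := mobiusMap α β h
            invFun := mobiusMap (conj α) (-β) h'
            left_inv := mobiusMap_leftInverse h h'
            right_inv := hr
            continuous_toFun := (contMDiff_mobiusMap h).continuous
            continuous_invFun := (contMDiff_mobiusMap h').continuous },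
    contMDiff_mobiusMap h, contMDiff_mobiusMap h'⟩, h, mobiusMap_mul h⟩

namespace IsMobius

variable {φ ψ : AutHol 𝓘(ℂ) Disk} {α β γ δ : ℂ}

theorem mul (hφ : IsMobius φ α β) (hψ : IsMobius ψ γ δ) :
    IsMobius (φ * ψ) (α * γ + β * conj δ) (α * δ + β * conj γ) := by
  constructor
  · have h := mul_pos (sub_pos.2 hφ.normSq_lt) (sub_pos.2 hψ.normSq_lt)
    rw [← sub_pos]
    refine h.trans_eq ?_
    simp only [Complex.normSq_apply, Complex.add_re, Complex.add_im, Complex.mul_re,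
      Complex.mul_im, Complex.conj_re, Complex.conj_im]
    ring
  · intro z
    have e1 := hψ.smul_mul z
    have e2 := hφ.smul_mul (ψ • z)
    rw [mul_smul]
    simp only [map_add, map_mul, Complex.conj_conj]
    linear_combination (conj δ * z + conj γ) * e2 +
      (α - conj β * ((φ • ψ • z : Disk) : ℂ)) * e1

theorem inv (hφ : IsMobius φ α β) : IsMobius φ⁻¹ (conj α) (-β) := by
  constructor
  · simpa using hφ.normSq_lt
  · intro z
    have e := hφ.smul_mul (φ⁻¹ • z)
    rw [smul_inv_smul] at e
    simp only [map_neg, Complex.conj_conj]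
    linear_combination -e

theorem conj_mul (hφ : IsMobius φ α β) (hψ : IsMobius ψ γ δ) :
    IsMobius (ψ⁻¹ * φ * ψ) ((conj γ * α - δ * conj β) * γ + (conj γ * β - δ * conj α) * conj δ)
      ((conj γ * α - δ * conj β) * δ + (conj γ * β - δ * conj α) * conj γ) := by
  have h := (hψ.inv.mul hφ).mul hψ
  simpa only [neg_mul, ← sub_eq_add_neg] using h

theorem left_ne_zero (hφ : IsMobius φ α β) : α ≠ 0 := by
  rintro rfl
  have := hφ.normSq_lt
  rw [Complex.normSq_zero] at this
  exact absurd (Complex.normSq_nonneg _) (not_le.2 this)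

theorem smul_zero_eq (hφ : IsMobius φ α β) : ((φ • (0 : Disk) : Disk) : ℂ) = β / conj α := by
  have h := hφ.smul_mul 0
  simp only [Disk.coe_zero, mul_zero, zero_add] at h
  rw [eq_div_iff ((map_ne_zero _).2 hφ.left_ne_zero), h]

/-- The modulus of this derivative is 1 − |φ(0)|² and its argument is twice that of α. So for equal
|φ(0)| only the phase of α distinguishes derivatives. -/
theorem hasStrictDerivAt_zero (hφ : IsMobius φ α β) :
    HasStrictDerivAt (Disk.extend fun z => φ • z)
      ((Complex.normSq α - Complex.normSq β : ℝ) / conj α ^ 2) 0 := by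
  have hα : conj α ≠ 0 := (map_ne_zero _).2 hφ.left_ne_zero
  have h1 : HasStrictDerivAt (fun z : ℂ => α * z + β) α 0 := by
    simpa using ((hasStrictDerivAt_id (0 : ℂ)).const_mul α).add_const β
  have h2 : HasStrictDerivAt (fun z : ℂ => conj β * z + conj α) (conj β) 0 := by
    simpa using ((hasStrictDerivAt_id (0 : ℂ)).const_mul (conj β)).add_const (conj α)
  have h3 := h1.div h2 (by simpa using hα)
  have h4 : HasStrictDerivAt (Disk.extend fun z => φ • z) _ 0 := h3.congr_of_eventuallyEq (by
    filter_upwards [ball_mem_nhds (0 : ℂ) one_pos] with z hz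
    have := hφ.smul_mul ⟨z, hz⟩
    rw [Pi.div_apply, div_eq_iff (mobius_denom_ne_zero hφ.normSq_lt hz), ← this]
    congr 1
    exact (Disk.extend_coe (fun z => φ • z) ⟨z, hz⟩).symm)
  convert h4 using 1
  simp only [mul_zero, zero_add]
  congr 1
  push_cast
  rw [← Complex.mul_conj, ← Complex.mul_conj]

theorem right_ne_zero (hφ : IsMobius φ α β) (hfree : ∀ z : Disk, φ • z ≠ z) : β ≠ 0 := by
  rintro rfl
  refine hfree 0 (Subtype.ext ?_)
  rw [hφ.smul_zero_eq, zero_div, Disk.coe_zero]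

/-- A Möbius transformation of the disk of vanishing trace has a fixed point. -/
theorem re_ne_zero (hφ : IsMobius φ α β) (hfree : ∀ z : Disk, φ • z ≠ z) : α.re ≠ 0 := by
  intro hre
  set τ := α.im with hτ
  have hα : α = Complex.I * τ := by
    apply Complex.ext <;> simp [hre, hτ]
  have hlt : Complex.normSq β < τ ^ 2 := by
    have := hφ.normSq_lt
    rw [Complex.normSq_apply α, hre] at this
    nlinarith
  have hroot := Real.sq_sqrt (sub_nonneg.2 hlt.le)
  have hroot0 := Real.sqrt_nonneg (τ ^ 2 - Complex.normSq β)
  set R := Real.sqrt (τ ^ 2 - Complex.normSq β)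
  -- With α = iτ, the point iβ/k is fixed exactly for roots k of this quadratic; the root of larger
  -- modulus has |k| ≥ |τ| > |β|, so the point lies in the disk.
  obtain ⟨k, hk, hkτ⟩ : ∃ k : ℝ, k ^ 2 - 2 * τ * k + Complex.normSq β = 0 ∧ τ ^ 2 ≤ k ^ 2 := by
    rcases le_total 0 τ with h | h
    · exact ⟨τ + R, by nlinarith, by nlinarith⟩
    · exact ⟨τ - R, by nlinarith, by nlinarith⟩
  have hk2 : 0 < k ^ 2 := ((Complex.normSq_nonneg β).trans_lt hlt).trans_le hkτ
  have hk0 : k ≠ 0 := by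
    rintro rfl
    simp at hk2
  have hmem : Complex.I * β / k ∈ ball (0 : ℂ) 1 := by
    rw [mem_ball_zero_iff, ← sq_lt_one_iff₀ (norm_nonneg _), ← Complex.normSq_eq_norm_sq,
      Complex.normSq_div, Complex.normSq_mul, Complex.normSq_I, Complex.normSq_ofReal, one_mul,
      ← sq, div_lt_one hk2]
    linarith
  refine hfree ⟨_, hmem⟩ (Subtype.ext (mul_right_cancel₀
    (mobius_denom_ne_zero hφ.normSq_lt hmem) ((hφ.smul_mul ⟨_, hmem⟩).trans ?_)))
  have hk0' : (k : ℂ) ≠ 0 := Complex.ofReal_ne_zero.2 hk0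
  have hkC : (k : ℂ) ^ 2 - 2 * τ * k + β * conj β = 0 := by
    rw [Complex.mul_conj]
    exact_mod_cast hk
  have hcα : conj α = -(Complex.I * τ) := by rw [hα]; simp
  simp only
  rw [hcα, hα]
  field_simp
  linear_combination β * hkC + (β * (2 * τ * k - β * conj β)) * Complex.I_sq

end IsMobius

/-- Every holomorphic automorphism of the disk is a Möbius transformation. -/
theorem AutHol.exists_isMobius (φ : AutHol 𝓘(ℂ) Disk) : ∃ α β : ℂ, IsMobius φ α β := by
  obtain ⟨χ, hχ⟩ := _root_.exists_isMobius (α := 1) (β := ((φ • (0 : Disk) : Disk) : ℂ))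
    (by simpa using (φ • (0 : Disk)).normSq_lt_one)
  have hχ0 : χ • (0 : Disk) = φ • (0 : Disk) := Subtype.ext (by simp [hχ.smul_zero_eq])
  set ψ := χ⁻¹ * φ with hψ
  have hψ0 : ψ • (0 : Disk) = 0 := by rw [hψ, mul_smul, ← hχ0, inv_smul_smul]
  have schwarz : ∀ θ : AutHol 𝓘(ℂ) Disk, θ • (0 : Disk) = 0 →
      DifferentiableOn ℂ (Disk.extend fun z => θ • z) (ball 0 1) ∧
      MapsTo (Disk.extend fun z => θ • z) (ball 0 1)
        (closedBall (Disk.extend (fun z => θ • z) 0) 1) ∧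
      ∀ z : Disk, ‖((θ • z : Disk) : ℂ)‖ ≤ ‖(z : ℂ)‖ := by
    intro θ hθ
    have h0 : Disk.extend (fun z => θ • z) 0 = 0 := by
      have := Disk.extend_coe (fun z => θ • z) 0
      rwa [hθ] at this
    have hd := Disk.differentiableOn_extend (G := fun z => θ • z) θ.2.1
    have hm : MapsTo (Disk.extend fun z => θ • z) (ball 0 1)
        (closedBall (Disk.extend (fun z => θ • z) 0) 1) := by
      rw [h0]
      exact (Disk.mapsTo_extend _).mono_right ball_subset_closedBall
    refine ⟨hd, hm, fun z => ?_⟩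
    have := Complex.dist_le_dist_of_mapsTo_ball hd hm z.2
    rw [h0, dist_zero_right, dist_zero_right, Disk.extend_coe] at this
    exact this
  obtain ⟨hd, hm, hle⟩ := schwarz ψ hψ0
  -- Schwarz for ψ and ψ⁻¹ gives |ψ z| = |z|, the equality case, so ψ is a rotation.
  have hge := (schwarz ψ⁻¹ (inv_smul_eq_iff.2 hψ0.symm)).2.2
  have hf0 : Disk.extend (fun z => ψ • z) 0 = 0 := by
    have := Disk.extend_coe (fun z => ψ • z) 0
    rwa [hψ0] at this
  have hhalf : (1 / 2 : ℂ) ∈ ball (0 : ℂ) 1 := by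
    rw [mem_ball_zero_iff]; norm_num
  obtain ⟨C, hC, hCeq⟩ := Complex.affine_of_mapsTo_ball_of_exists_norm_dslope_eq_div' hd hm
    ⟨1 / 2, hhalf, by
      have h1 := hle ⟨_, hhalf⟩
      have h2 := hge (ψ • ⟨_, hhalf⟩)
      rw [inv_smul_smul] at h2
      have h3 := le_antisymm h1 h2
      have h4 := Disk.extend_coe (fun z => ψ • z) ⟨_, hhalf⟩
      simp only at h3 h4
      rw [dslope_of_ne _ (by norm_num), slope_def_field, hf0, sub_zero, sub_zero, h4, norm_div, h3]
      norm_num⟩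
  rw [div_one] at hC
  -- The pair (v, 0) represents z ↦ (v / conj v) z = v² z, so a square root of C is needed.
  obtain ⟨v, hv⟩ := IsAlgClosed.exists_pow_nat_eq C (n := 2) (by norm_num)
  have hv1 : Complex.normSq v = 1 := by
    have h : Complex.normSq v ^ 2 = 1 := by
      rw [← map_pow, hv, Complex.normSq_eq_norm_sq, hC, one_pow]
    exact (pow_eq_one_iff_of_nonneg (Complex.normSq_nonneg v) (by norm_num)).1 h
  have hψM : IsMobius ψ v 0 := by
    refine ⟨by simp [hv1], fun z => ?_⟩
    have h := hCeq z.2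
    rw [Disk.extend_coe] at h
    simp only [hf0, zero_add, sub_zero, smul_eq_mul] at h
    have hvv : v * conj v = 1 := by rw [Complex.mul_conj, hv1, Complex.ofReal_one]
    rw [h, map_zero, ← hv]
    linear_combination z * v * hvv
  have := hχ.mul hψM
  rw [hψ, mul_inv_cancel_left] at this
  exact ⟨_, _, this⟩

/-- A fixed point free automorphism `φ` of the disk can be conjugated so that `0` is displaced by
any prescribed large distance and the derivative at `0` is not real. -/
theorem IsMobius.exists_conj {φ : AutHol 𝓘(ℂ) Disk} {α β : ℂ} (hφ : IsMobius φ α β)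
    (hfree : ∀ z : Disk, φ • z ≠ z) :
    ∃ m₀ > 0, ∀ m : ℝ, 0 < m → m ≤ m₀ → ∃ (a : AutHol 𝓘(ℂ) Disk) (α' β' : ℂ),
      IsMobius (a⁻¹ * φ * a) α' β' ∧ α'.im ≠ 0 ∧
        Complex.normSq α' - Complex.normSq β' = m * Complex.normSq α' := by
  have hβ : 0 < ‖β‖ := norm_pos_iff.2 (hφ.right_ne_zero hfree)
  -- τ = ±|β|, with the sign of Im α, so that the two terms of Im (A s) cannot cancel.
  obtain ⟨τ, hτ, hτα⟩ : ∃ τ : ℝ, τ ^ 2 = Complex.normSq β ∧ 0 ≤ τ * α.im := by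
    rw [Complex.normSq_eq_norm_sq]
    rcases le_total 0 α.im with h | h
    · exact ⟨‖β‖, rfl, mul_nonneg hβ.le h⟩
    · exact ⟨-‖β‖, by ring, mul_nonneg_of_nonpos_of_nonpos (by linarith) h⟩
  have hτ0 : τ ≠ 0 := by
    rintro rfl
    rw [Complex.normSq_eq_norm_sq] at hτ
    nlinarith
  set D := Complex.normSq α - Complex.normSq β with hD
  have hDpos : 0 < D := sub_pos.2 hφ.normSq_lt
  let A : ℝ → ℂ := fun s => α - (s : ℂ) ^ 2 * conj α + 2 * Complex.I * s * τ
  have hAim : ∀ s, (A s).im = α.im * (1 + s ^ 2) + 2 * s * τ := by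
    intro s
    simp [A, ← Complex.ofReal_pow, Complex.add_im, Complex.mul_im]
    ring
  have hAim0 : ∀ s, 0 < s → (A s).im ≠ 0 := by
    intro s hs h0
    rw [hAim] at h0
    have h1 : 0 ≤ τ * α.im * (1 + s ^ 2) := by positivity
    have h2 : 0 < 2 * s * τ ^ 2 := by positivity
    have h3 : τ * (α.im * (1 + s ^ 2) + 2 * s * τ) = 0 := by rw [h0, mul_zero]
    nlinarith
  have hApos : ∀ s, 0 < s → 0 < Complex.normSq (A s) := by
    intro s hs
    refine Complex.normSq_pos.2 fun h => hAim0 s hs ?_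
    rw [h, Complex.zero_im]
  -- `A s` will be the new α after moving the base point to distance s from 0, and `d s` is 1 −
  -- |displaced 0|². It tends to 0 as s → 1, so the intermediate value theorem reaches every small
  -- m. The lower end 1/2 only keeps s positive, where `A s` ≠ 0.
  let d : ℝ → ℝ := fun s => D * (1 - s ^ 2) ^ 2 / Complex.normSq (A s)
  have hd : ContinuousOn d (Icc (1 / 2) 1) := by
    refine ContinuousOn.div (by fun_prop) ?_ fun s hs => (hApos s (by linarith [hs.1])).ne'
    refine (Complex.continuous_normSq.comp ?_).continuousOn
    fun_prop
  have hd1 : d 1 = 0 := by simp [d]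
  refine ⟨d (1 / 2), div_pos (by positivity) (hApos _ (by norm_num)), fun m hm hm0 => ?_⟩
  obtain ⟨s, hs, hsm⟩ := intermediate_value_Icc' (by norm_num) hd
    (show m ∈ Icc (d 1) (d (1 / 2)) from ⟨by rw [hd1]; exact hm.le, hm0⟩)
  have hs0 : 0 < s := by linarith [hs.1]
  have hs1 : s < 1 := by
    refine lt_of_le_of_ne hs.2 ?_
    rintro rfl
    rw [hd1] at hsm
    exact hm.ne hsm
  have hτC : (τ : ℂ) ^ 2 = β * conj β := by rw [Complex.mul_conj, ← hτ]; push_cast; rfl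
  have hτC0 : (τ : ℂ) ≠ 0 := Complex.ofReal_ne_zero.2 hτ0
  -- This direction makes p · conj β = −isτ purely imaginary, which yields the term 2isτ in `A s`.
  set p : ℂ := -(Complex.I * s * β / τ) with hp
  have hcp : conj p = Complex.I * s * conj β / τ := by
    rw [hp]
    simp only [map_neg, map_div₀, map_mul, Complex.conj_I, Complex.conj_ofReal]
    ring
  have hpp : p * conj p = (s : ℂ) ^ 2 := by
    rw [hcp, hp]
    field_simp
    linear_combination (-(s : ℂ) ^ 2 * β * conj β) * Complex.I_sq - (s : ℂ) ^ 2 * hτC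
  have hpn : Complex.normSq p = s ^ 2 := by
    rw [Complex.mul_conj] at hpp
    exact_mod_cast hpp
  obtain ⟨a, ha⟩ := exists_isMobius (α := 1) (β := p) (by
    rw [hpn, map_one]; nlinarith)
  have hconj := hφ.conj_mul ha
  have hα' : (conj 1 * α - p * conj β) * 1 + (conj 1 * β - p * conj α) * conj p = A s := by
    have e1 : p * conj β = -(Complex.I * s * τ) := by
      rw [hp]
      field_simp
      linear_combination s * hτC
    have e2 : β * conj p = Complex.I * s * τ := by
      rw [hcp]
      field_simp
      linear_combination -(s * hτC)
    simp only [map_one, A]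
    linear_combination -e1 + e2 - conj α * hpp
  have hdet : Complex.normSq ((conj 1 * α - p * conj β) * 1 + (conj 1 * β - p * conj α) * conj p)
      - Complex.normSq ((conj 1 * α - p * conj β) * p + (conj 1 * β - p * conj α) * conj 1)
      = D * (1 - Complex.normSq p) ^ 2 := by
    simp only [hD, map_one, Complex.normSq_apply, Complex.add_re, Complex.add_im, Complex.mul_re,
      Complex.mul_im, Complex.conj_re, Complex.conj_im, Complex.sub_re, Complex.sub_im,
      Complex.one_re, Complex.one_im]
    ring
  refine ⟨a, _, _, hconj, ?_, ?_⟩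
  · rw [hα']
    exact hAim0 s hs0
  · rw [hdet, hα', hpn, ← hsm]
    exact (div_mul_cancel₀ _ (hApos s hs0).ne').symm

/-- Two fixed point free automorphisms `φ₁`, `φ₂` of the disk can be conjugated, after possibly
replacing `φ₂` by its inverse, so that they agree at `0` but have different derivatives there. -/
theorem AutHol.exists_conj_smul_zero_eq_and_deriv_ne (φ₁ φ₂ : AutHol 𝓘(ℂ) Disk)
    (h₁ : ∀ z : Disk, φ₁ • z ≠ z) (h₂ : ∀ z : Disk, φ₂ • z ≠ z) :
    ∃ a b ψ : AutHol 𝓘(ℂ) Disk, (ψ = φ₂ ∨ ψ = φ₂⁻¹) ∧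
      (a⁻¹ * φ₁ * a) • (0 : Disk) = (b⁻¹ * ψ * b) • (0 : Disk) ∧
      ∃ d₁ d₂ : ℂ, HasStrictDerivAt (Disk.extend fun z => (a⁻¹ * φ₁ * a) • z) d₁ 0 ∧
        HasStrictDerivAt (Disk.extend fun z => (b⁻¹ * ψ * b) • z) d₂ 0 ∧ d₁ ≠ d₂ := by
  obtain ⟨_, _, hM₁⟩ := AutHol.exists_isMobius φ₁
  obtain ⟨_, _, hM₂⟩ := AutHol.exists_isMobius φ₂
  obtain ⟨m₁, hm₁, H₁⟩ := hM₁.exists_conj h₁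
  obtain ⟨m₂, hm₂, H₂⟩ := hM₂.exists_conj h₂
  have hm : 0 < min m₁ m₂ := lt_min hm₁ hm₂
  set m := min m₁ m₂
  obtain ⟨a, α₁, β₁, hA, -, hdet₁⟩ := H₁ m hm (min_le_left _ _)
  obtain ⟨b, α₂, β₂, hB, him, hdet₂⟩ := H₂ m hm (min_le_right _ _)
  have hfree₂ : ∀ z : Disk, (b⁻¹ * φ₂ * b) • z ≠ z := by
    intro z hz
    rw [mul_smul, mul_smul, inv_smul_eq_iff] at hz
    exact h₂ _ hz
  have hre : α₂.re ≠ 0 := hB.re_ne_zero hfree₂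
  have hβ₂ : β₂ ≠ 0 := hB.right_ne_zero hfree₂
  -- one of the two candidates for `ψ` has the right derivative
  obtain ⟨ψ, α, β, hψ, hC, hβ, hdet, hne⟩ : ∃ (ψ : AutHol 𝓘(ℂ) Disk) (α β : ℂ),
      (ψ = φ₂ ∨ ψ = φ₂⁻¹) ∧ IsMobius (b⁻¹ * ψ * b) α β ∧ β ≠ 0 ∧
        Complex.normSq α - Complex.normSq β = m * Complex.normSq α ∧
        α₁ * conj α ≠ α * conj α₁ := by
    -- The derivatives will be m α₁ / conj α₁ and m α / conj α. Inversion conjugates α₂, so if both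
    -- candidates failed then α₂² would be real, against Re α₂ ≠ 0 ≠ Im α₂.
    by_cases hne : α₁ * conj α₂ = α₂ * conj α₁
    · refine ⟨φ₂⁻¹, conj α₂, -β₂, Or.inr rfl, ?_, neg_ne_zero.2 hβ₂, by simpa using hdet₂, ?_⟩
      · have := hB.inv
        rwa [mul_inv_rev, mul_inv_rev, inv_inv, ← mul_assoc] at this
      · rw [Complex.conj_conj]
        intro h
        have hα₁ := hA.left_ne_zero
        have h3 : α₁ * (α₂ ^ 2 - conj α₂ ^ 2) = 0 := by
          linear_combination α₂ * h - conj α₂ * hne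
        have h4 : α₂ ^ 2 - conj α₂ ^ 2 = 0 := (mul_eq_zero.1 h3).resolve_left hα₁
        have h5 := congrArg Complex.im h4
        simp [sq] at h5
        have h6 : 4 * (α₂.re * α₂.im) = 0 := by linarith
        exact mul_ne_zero hre him (by linarith)
    · exact ⟨φ₂, α₂, β₂, Or.inl rfl, hB, hβ₂, hdet₂, hne⟩
  have hα₁ := hA.left_ne_zero
  have hα := hC.left_ne_zero
  have hcα₁ : conj α₁ ≠ 0 := (map_ne_zero _).2 hα₁
  have hcα : conj α ≠ 0 := (map_ne_zero _).2 hα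
  -- a rotation makes the values at `0` agree
  have hnorm : Complex.normSq (β₁ * conj α / (conj α₁ * β)) = 1 := by
    have n1 := Complex.normSq_pos.2 hα₁
    have n2 := Complex.normSq_pos.2 hβ
    rw [Complex.normSq_div, Complex.normSq_mul, Complex.normSq_mul, Complex.normSq_conj,
      Complex.normSq_conj, div_eq_one_iff_eq (mul_pos n1 n2).ne']
    linear_combination (-Complex.normSq α) * hdet₁ + Complex.normSq α₁ * hdet
  -- Conjugation by z ↦ u² z fixes α and multiplies β by conj u², so it aligns the values at 0
  -- without changing the derivative.
  obtain ⟨u, hu⟩ := IsAlgClosed.exists_pow_nat_eq (conj (β₁ * conj α / (conj α₁ * β))) (n := 2)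
    (by norm_num)
  have hu1 : Complex.normSq u = 1 := by
    have h : Complex.normSq u ^ 2 = 1 := by
      rw [← map_pow, hu, Complex.normSq_conj, hnorm]
    exact (pow_eq_one_iff_of_nonneg (Complex.normSq_nonneg u) (by norm_num)).1 h
  have huu : u * conj u = 1 := by rw [Complex.mul_conj, hu1, Complex.ofReal_one]
  have hcu : conj u ^ 2 = β₁ * conj α / (conj α₁ * β) := by
    rw [← map_pow, hu, Complex.conj_conj]
  obtain ⟨r, hr⟩ := _root_.exists_isMobius (α := u) (β := 0) (by simp [hu1])
  have hE : IsMobius ((b * r)⁻¹ * ψ * (b * r)) α (conj u ^ 2 * β) := by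
    have h := hC.conj_mul hr
    have e : r⁻¹ * (b⁻¹ * ψ * b) * r = (b * r)⁻¹ * ψ * (b * r) := by group
    rw [e] at h
    convert h using 1
    · simp only [map_zero]
      linear_combination -α * huu
    · ring
  refine ⟨a, b * r, ψ, hψ, ?_, _, _, hA.hasStrictDerivAt_zero, hE.hasStrictDerivAt_zero, ?_⟩
  · refine Subtype.ext ?_
    rw [hA.smul_zero_eq, hE.smul_zero_eq, hcu]
    field_simp
  · have hnu : Complex.normSq (conj u ^ 2 * β) = Complex.normSq β := by
      rw [map_mul, map_pow, Complex.normSq_conj, hu1, one_pow, one_mul]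
    rw [hnu, hdet₁, hdet]
    push_cast
    rw [← Complex.mul_conj, ← Complex.mul_conj]
    intro h
    have hm0 : (m : ℂ) ≠ 0 := Complex.ofReal_ne_zero.2 hm.ne'
    field_simp at h
    exact hne (h.trans (mul_comm _ _))

end Mobius

/-! ### Comparison of the two metrics -/

section Comparison

open Metric Set

theorem AutHol.IsKleinian.smul_ne {E : Type*} [NormedAddCommGroup E] [NormedSpace ℂ E]
    {H : Type*} [TopologicalSpace H] {I : ModelWithCorners ℂ E H} {M : Type*} [TopologicalSpace M]
    [ChartedSpace H M] {Γ : Subgroup (AutHol I M)} (hΓ : AutHol.IsKleinian Γ) {φ : AutHol I M}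
    (hφ : φ ∈ Γ) (h1 : φ ≠ 1) (z : M) : φ • z ≠ z := by
  intro hz
  obtain ⟨U, -, hzU, hU⟩ := hΓ.exists_open z
  exact h1 (hU φ hφ ⟨z, ⟨z, hzU, hz⟩, hzU⟩)

variable (Γ : Subgroup (AutHol (𝓘(ℂ).prod 𝓘(ℂ)) (Disk × Disk))) [AutHol.IsKleinian Γ]
  (T : AutHol (𝓘(ℂ).prod 𝓘(ℂ)) (Disk × Disk))

/-- The covering `△² → △² / Γ` precomposed with an automorphism of the bidisk. -/
noncomputable def bidiskCover (p : Disk × Disk) : AutHol.Quotient Γ :=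
  AutHol.Quotient.mk Γ (T • p)

theorem contMDiff_bidiskCover :
    ContMDiff (𝓘(ℂ).prod 𝓘(ℂ)) (𝓘(ℂ).prod 𝓘(ℂ)) ω (bidiskCover Γ T) :=
  (AutHol.Quotient.contMDiff_mk Γ).comp T.2.1

theorem injective_mfderiv_bidiskCover (p : Disk × Disk) : Function.Injective
    (mfderiv (𝓘(ℂ).prod 𝓘(ℂ)) (𝓘(ℂ).prod 𝓘(ℂ)) (bidiskCover Γ T) p) := by
  have hT : ∀ p : Disk × Disk,
      MDifferentiableAt (𝓘(ℂ).prod 𝓘(ℂ)) (𝓘(ℂ).prod 𝓘(ℂ)) (fun p => T • p) p :=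
    fun p => (T.2.1 p).mdifferentiableAt (by simp)
  have hT' : ∀ p : Disk × Disk,
      MDifferentiableAt (𝓘(ℂ).prod 𝓘(ℂ)) (𝓘(ℂ).prod 𝓘(ℂ)) (fun p => T⁻¹ • p) p :=
    fun p => (T.2.2 p).mdifferentiableAt (by simp)
  have hmk := (AutHol.Quotient.contMDiff_mk Γ (T • p)).mdifferentiableAt (by simp)
  have e1 := mfderiv_comp p hmk (hT p)
  have e2 := mfderiv_comp p (hT' (T • p)) (hT p)
  have e3 : (fun p : Disk × Disk => T⁻¹ • p) ∘ (fun p => T • p) = id :=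
    funext fun p => inv_smul_smul T p
  rw [e3, mfderiv_id] at e2
  change Function.Injective (mfderiv (𝓘(ℂ).prod 𝓘(ℂ)) (𝓘(ℂ).prod 𝓘(ℂ))
    (AutHol.Quotient.mk Γ ∘ fun p => T • p) p)
  rw [e1]
  refine (AutHol.Quotient.injective_mfderiv_mk Γ (T • p)).comp fun u v huv => ?_
  have hu := DFunLike.congr_fun e2 u
  have hv := DFunLike.congr_fun e2 v
  exact hu.trans ((congrArg (mfderiv (𝓘(ℂ).prod 𝓘(ℂ)) (𝓘(ℂ).prod 𝓘(ℂ))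
    (fun p => T⁻¹ • p) (T • p)) huv).trans hv.symm)

/-- The image in `△² / Γ` of the tangent vector `(1, 1)` at the centre of the bidisk. -/
noncomputable def bidiskVector : TangentBundle (𝓘(ℂ).prod 𝓘(ℂ)) (AutHol.Quotient Γ) :=
  tangentMap (𝓘(ℂ).prod 𝓘(ℂ)) (𝓘(ℂ).prod 𝓘(ℂ)) (bidiskCover Γ T)
    ⟨((0 : Disk), (0 : Disk)), ((1 : ℂ), (1 : ℂ))⟩

variable {Γ T}

/-- A disc in `△² / Γ` tangent to a multiple of `bidiskVector` is covered by a pair of normalized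
self-maps of the disk. -/
theorem exists_isNormalizedSelfMap_lift {f : Disk → AutHol.Quotient Γ} {lam : ℝ}
    (hf : ContMDiff 𝓘(ℂ) (𝓘(ℂ).prod 𝓘(ℂ)) ω f)
    (h : tangentMap 𝓘(ℂ) (𝓘(ℂ).prod 𝓘(ℂ)) f ⟨0, (1 : ℂ)⟩ =
      ⟨(bidiskVector Γ T).1, (lam : ℂ) • (bidiskVector Γ T).2⟩) :
    ∃ G₁ G₂ : Disk → Disk, IsNormalizedSelfMap (Disk.extend G₁) lam ∧
      IsNormalizedSelfMap (Disk.extend G₂) lam ∧ ∀ z, bidiskCover Γ T (G₁ z, G₂ z) = f z := by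
  obtain ⟨h0, hd⟩ := Bundle.TotalSpace.mk.inj h
  obtain ⟨F, hF, hF0, hFf⟩ := AutHol.Quotient.exists_contMDiff_lift Γ hf
    (m := T • ((0 : Disk), (0 : Disk))) h0.symm
  have hTF : ContMDiff 𝓘(ℂ) (𝓘(ℂ).prod 𝓘(ℂ)) ω (fun z => T⁻¹ • F z) := T.2.2.comp hF
  have h1 : ContMDiff 𝓘(ℂ) 𝓘(ℂ) ω (fun z => (T⁻¹ • F z).1) := contMDiff_fst.comp hTF
  have h2 : ContMDiff 𝓘(ℂ) 𝓘(ℂ) ω (fun z => (T⁻¹ • F z).2) := contMDiff_snd.comp hTF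
  have hcov : ∀ z, bidiskCover Γ T ((T⁻¹ • F z).1, (T⁻¹ • F z).2) = f z := by
    intro z
    rw [← hFf, bidiskCover, Prod.mk.eta, smul_inv_smul]
  have hz : T⁻¹ • F 0 = ((0 : Disk), (0 : Disk)) := by rw [hF0, inv_smul_smul]
  set G₁ : Disk → Disk := fun z => (T⁻¹ • F z).1 with hG₁
  set G₂ : Disk → Disk := fun z => (T⁻¹ • F z).2 with hG₂
  have hz1 : G₁ 0 = 0 := congrArg Prod.fst hz
  have hz2 : G₂ 0 = 0 := congrArg Prod.snd hz
  have d1 := (h1 0).mdifferentiableAt (n := ω) (by simp)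
  have d2 := (h2 0).mdifferentiableAt (n := ω) (by simp)
  have e1 := mfderiv_prodMk d1 d2
  have e2 := mfderiv_comp (0 : Disk) (g := bidiskCover Γ T) (f := fun z => (G₁ z, G₂ z))
    ((contMDiff_bidiskCover Γ T _).mdifferentiableAt (by simp)) (d1.prodMk d2)
  have e3 : bidiskCover Γ T ∘ (fun z => (G₁ z, G₂ z)) = f := funext hcov
  have hd' : mfderiv 𝓘(ℂ) (𝓘(ℂ).prod 𝓘(ℂ)) f 0 (1 : ℂ) =
      (lam : ℂ) • (bidiskVector Γ T).2 := eq_of_heq hd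
  have hv : ((bidiskVector Γ T).2 : ℂ × ℂ) = mfderiv (𝓘(ℂ).prod 𝓘(ℂ)) (𝓘(ℂ).prod 𝓘(ℂ))
      (bidiskCover Γ T) (G₁ 0, G₂ 0) ((1, 1) : ℂ × ℂ) := by
    rw [hz1, hz2]
    rfl
  let V : ℂ × ℂ →L[ℂ] ℂ × ℂ :=
    mfderiv (𝓘(ℂ).prod 𝓘(ℂ)) (𝓘(ℂ).prod 𝓘(ℂ)) (bidiskCover Γ T) (G₁ 0, G₂ 0)
  -- Both sides are df(0)(1); injectivity of the differential of the covering then identifies the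
  -- derivatives upstairs.
  have e4 : V (mfderiv 𝓘(ℂ) 𝓘(ℂ) G₁ 0 (1 : ℂ), mfderiv 𝓘(ℂ) 𝓘(ℂ) G₂ 0 (1 : ℂ)) =
      V ((lam : ℂ), (lam : ℂ)) := by
    rw [e3, e1] at e2
    have hlam : (((lam : ℂ), (lam : ℂ)) : ℂ × ℂ) = (lam : ℂ) • ((1, 1) : ℂ × ℂ) := by simp
    rw [hlam, map_smul]
    exact (DFunLike.congr_fun e2 (1 : ℂ)).symm.trans
      (hd'.trans (congrArg (fun w : ℂ × ℂ => (lam : ℂ) • w) hv))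
  have e5 := injective_mfderiv_bidiskCover Γ T _ e4
  have e6 : (mfderiv 𝓘(ℂ) 𝓘(ℂ) G₁ 0 (1 : ℂ) : ℂ) = (lam : ℂ) := congrArg Prod.fst e5
  have e7 : (mfderiv 𝓘(ℂ) 𝓘(ℂ) G₂ 0 (1 : ℂ) : ℂ) = (lam : ℂ) := congrArg Prod.snd e5
  have key : ∀ {G : Disk → Disk}, ContMDiff 𝓘(ℂ) 𝓘(ℂ) ω G → G 0 = 0 →
      (mfderiv 𝓘(ℂ) 𝓘(ℂ) G 0 (1 : ℂ) : ℂ) = (lam : ℂ) → IsNormalizedSelfMap (Disk.extend G) lam := by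
    intro G hG hG0 hGd
    refine ⟨Disk.differentiableOn_extend hG, Disk.mapsTo_extend G, ?_,
      Disk.deriv_extend_zero hG hG0 hGd⟩
    have := Disk.extend_coe G 0
    rwa [hG0] at this
  exact ⟨G₁, G₂, key h1 hz1 e6, key h2 hz2 e7, hcov⟩

variable (Γ T)

/-- The diagonal disc in `△² / Γ`. -/
noncomputable def diagonalDisc : Disk → AutHol.Quotient Γ := bidiskCover Γ T ∘ fun z => (z, z)

theorem contMDiff_diagonalDisc : ContMDiff 𝓘(ℂ) (𝓘(ℂ).prod 𝓘(ℂ)) ω (diagonalDisc Γ T) :=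
  (contMDiff_bidiskCover Γ T).comp (contMDiff_id.prodMk contMDiff_id)

theorem tangentMap_diagonalDisc :
    tangentMap 𝓘(ℂ) (𝓘(ℂ).prod 𝓘(ℂ)) (diagonalDisc Γ T) ⟨0, (1 : ℂ)⟩ = bidiskVector Γ T := by
  have hdiag : ContMDiff 𝓘(ℂ) (𝓘(ℂ).prod 𝓘(ℂ)) ω (fun z : Disk => (z, z)) :=
    contMDiff_id.prodMk contMDiff_id
  have hd := (hdiag 0).mdifferentiableAt (n := ω) (by simp)
  rw [diagonalDisc,
    tangentMap_comp_at _ ((contMDiff_bidiskCover Γ T _).mdifferentiableAt (by simp)) hd]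
  have e := mfderiv_prodMk (mdifferentiableAt_id (I := 𝓘(ℂ)) (x := (0 : Disk)))
    (mdifferentiableAt_id (I := 𝓘(ℂ)) (x := (0 : Disk)))
  rw [mfderiv_id] at e
  have e' : mfderiv 𝓘(ℂ) (𝓘(ℂ).prod 𝓘(ℂ)) (fun z : Disk => (z, z)) 0 (1 : ℂ) = ((1, 1) : ℂ × ℂ) :=
    DFunLike.congr_fun e (1 : ℂ)
  exact congrArg (fun w : ℂ × ℂ => tangentMap (𝓘(ℂ).prod 𝓘(ℂ)) (𝓘(ℂ).prod 𝓘(ℂ)) (bidiskCover Γ T)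
    ⟨((0 : Disk), (0 : Disk)), w⟩) e'

/-- Small diagonal discs are injective, so `bidiskVector` is tangent to an injective disc. -/
theorem exists_injective_tangentMap_eq_smul_bidiskVector :
    ∃ (f : Disk → AutHol.Quotient Γ) (lam : ℝ), ContMDiff 𝓘(ℂ) (𝓘(ℂ).prod 𝓘(ℂ)) ω f ∧
      Function.Injective f ∧ 0 < lam ∧ tangentMap 𝓘(ℂ) (𝓘(ℂ).prod 𝓘(ℂ)) f ⟨0, (1 : ℂ)⟩ =
        ⟨(bidiskVector Γ T).1, (lam : ℂ) • (bidiskVector Γ T).2⟩ := by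
  -- The local left inverse σ makes the projection injective near the base point; the diagonal disc
  -- is shrunk into that region.
  obtain ⟨-, σ, -, hσ⟩ :=
    AutHol.Quotient.contMDiffAt_mk_and_exists_leftInverse Γ (T • ((0 : Disk), (0 : Disk)))
  have hcont : Continuous fun z : Disk => T • (z, z) :=
    T.1.continuous.comp (continuous_id.prodMk continuous_id)
  obtain ⟨r, hr, hrσ⟩ := Metric.eventually_nhds_iff_ball.1
    ((hcont.continuousAt (x := (0 : Disk))).eventually hσ)
  obtain ⟨lam, hlam, hlam1, hlamr⟩ : ∃ lam : ℝ, 0 < lam ∧ lam ≤ 1 ∧ lam ≤ r :=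
    ⟨min 1 r, lt_min one_pos hr, min_le_left _ _, min_le_right _ _⟩
  have hnorm : ∀ z : Disk, ‖(lam : ℂ) * z‖ < lam := by
    intro z
    rw [norm_mul, Complex.norm_real, Real.norm_of_nonneg hlam.le]
    exact mul_lt_of_lt_one_right hlam z.norm_lt_one
  let s : Disk → Disk := fun z => ⟨(lam : ℂ) * z, mem_ball_zero_iff.2 ((hnorm z).trans_le hlam1)⟩
  have hs : ContMDiff 𝓘(ℂ) 𝓘(ℂ) ω s :=
    Disk.contMDiff_of_differentiableOn (f := fun z => (lam : ℂ) * z) (by fun_prop) fun _ => rfl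
  have hs0 : s 0 = 0 := Subtype.ext (mul_zero _)
  have hlam0 : (lam : ℂ) ≠ 0 := Complex.ofReal_ne_zero.2 hlam.ne'
  have hsinj : Function.Injective s := fun z w h =>
    Subtype.ext (mul_left_cancel₀ hlam0 (congrArg Subtype.val h))
  have hsball : ∀ z, s z ∈ ball (0 : Disk) r := by
    intro z
    rw [mem_ball, Subtype.dist_eq, Disk.coe_zero, dist_zero_right]
    exact (hnorm z).trans_le hlamr
  have hds : (mfderiv 𝓘(ℂ) 𝓘(ℂ) s 0 (1 : ℂ) : ℂ) = (lam : ℂ) := by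
    have hev : Disk.extend s =ᶠ[𝓝 0] fun z => (lam : ℂ) * z := by
      filter_upwards [ball_mem_nhds (0 : ℂ) one_pos] with z hz
      exact Disk.extend_coe s ⟨z, hz⟩
    have hderiv : deriv (Disk.extend s) 0 = lam := by
      rw [hev.deriv_eq]
      simp
    exact (Disk.deriv_extend_zero hs hs0 rfl).symm.trans hderiv
  refine ⟨diagonalDisc Γ T ∘ s, lam, (contMDiff_diagonalDisc Γ T).comp hs, ?_, hlam, ?_⟩
  · intro z w h
    have h1 := hrσ _ (hsball z)
    have h2 := hrσ _ (hsball w)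
    have h3 : T • (s z, s z) = T • (s w, s w) := h1.symm.trans ((congrArg σ h).trans h2)
    exact hsinj (congrArg Prod.fst (smul_left_cancel T h3))
  · rw [tangentMap_comp_at _ ((contMDiff_diagonalDisc Γ T _).mdifferentiableAt (by simp))
      ((hs 0).mdifferentiableAt (by simp)), ← tangentMap_diagonalDisc]
    let V : ℂ →L[ℂ] ℂ × ℂ := mfderiv 𝓘(ℂ) (𝓘(ℂ).prod 𝓘(ℂ)) (diagonalDisc Γ T) 0
    have hV : V lam = (lam : ℂ) • V 1 := by
      rw [← map_smul, smul_eq_mul, mul_one]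
    have h1 : tangentMap 𝓘(ℂ) 𝓘(ℂ) s ⟨0, (1 : ℂ)⟩ = ⟨(0 : Disk), (lam : ℂ)⟩ :=
      Bundle.TotalSpace.ext hs0 (heq_of_eq hds)
    rw [h1]
    exact congrArg (fun w : ℂ × ℂ => (⟨diagonalDisc Γ T 0, w⟩ :
      TangentBundle (𝓘(ℂ).prod 𝓘(ℂ)) (AutHol.Quotient Γ))) hV

variable {Γ T}

/-- The Kobayashi metric of `△² / Γ` at the vector `bidiskVector` equals `1`. -/
theorem kobayashiMetric_bidiskVector :
    kobayashiMetric (𝓘(ℂ).prod 𝓘(ℂ)) (AutHol.Quotient Γ) (bidiskVector Γ T) = 1 := by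
  refine IsLeast.csInf_eq ⟨?_, ?_⟩
  · refine ⟨diagonalDisc Γ T, 1, contMDiff_diagonalDisc Γ T, one_pos, ?_, by norm_num⟩
    rw [tangentMap_diagonalDisc, Complex.ofReal_one, one_smul]
  · rintro _ ⟨f, lam, hf, hlam, hft, rfl⟩
    obtain ⟨G₁, -, h₁, -⟩ := exists_isNormalizedSelfMap_lift hf hft
    rw [le_div_iff₀ hlam, one_mul]
    exact (le_abs_self lam).trans h₁.abs_le_one

end Comparison

/-- **Jarnicki's theorem.** If `Γ₁ ⊕ Γ₂` contains a pair of nontrivial automorphisms, then the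
injective Kobayashi metric of `△² / (Γ₁ ⊕ Γ₂)` differs from the Kobayashi metric. -/
theorem mainTheorem4 (Γ₁ Γ₂ : Subgroup (AutHol 𝓘(ℂ) Disk))
    [IsFuchsian Γ₁] [IsFuchsian Γ₂]
    (h : ∃ φ₁ φ₂ : AutHol 𝓘(ℂ) Disk,
      AutHol.prodHom 𝓘(ℂ) Disk 𝓘(ℂ) Disk (φ₁, φ₂) ∈ AutHol.directSum Γ₁ Γ₂ ∧ φ₁ ≠ 1 ∧ φ₂ ≠ 1) :
    injectiveKobayashiMetric (𝓘(ℂ).prod 𝓘(ℂ)) (AutHol.Quotient (AutHol.directSum Γ₁ Γ₂)) ≠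
      kobayashiMetric (𝓘(ℂ).prod 𝓘(ℂ)) (AutHol.Quotient (AutHol.directSum Γ₁ Γ₂)) := by
  obtain ⟨φ₁, φ₂, ⟨⟨θ₁, θ₂⟩, ⟨hθ₁, hθ₂⟩, hθ⟩, hφ₁, hφ₂⟩ := h
  have happ : ∀ z w : Disk, (θ₁ • z, θ₂ • w) = (φ₁ • z, φ₂ • w) := fun z w =>
    congrArg (fun χ : AutHol (𝓘(ℂ).prod 𝓘(ℂ)) (Disk × Disk) => χ • (z, w)) hθ
  have hθφ₁ : θ₁ = φ₁ := Subtype.ext (Homeomorph.ext fun z => congrArg Prod.fst (happ z 0))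
  have hθφ₂ : θ₂ = φ₂ := Subtype.ext (Homeomorph.ext fun z => congrArg Prod.snd (happ 0 z))
  have hmem₁ : φ₁ ∈ Γ₁ := hθφ₁ ▸ hθ₁
  have hmem₂ : φ₂ ∈ Γ₂ := hθφ₂ ▸ hθ₂
  have hfree₁ := AutHol.IsKleinian.smul_ne ‹IsFuchsian Γ₁› hmem₁ hφ₁
  have hfree₂ := AutHol.IsKleinian.smul_ne ‹IsFuchsian Γ₂› hmem₂ hφ₂
  obtain ⟨a, b, ψ, hψ, h0, d₁, d₂, hd₁, hd₂, hne⟩ :=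
    AutHol.exists_conj_smul_zero_eq_and_deriv_ne φ₁ φ₂ hfree₁ hfree₂
  have hψmem : ψ ∈ Γ₂ := by
    rcases hψ with rfl | rfl
    exacts [hmem₂, inv_mem hmem₂]
  obtain ⟨ε, hε, hsol⟩ := exists_common_solution_of_deriv_ne
    (((a⁻¹ * φ₁ * a) • (0 : Disk)).norm_lt_one)
    (Disk.extend_coe (fun z => (a⁻¹ * φ₁ * a) • z) 0)
    ((Disk.extend_coe (fun z => (b⁻¹ * ψ * b) • z) 0).trans (congrArg Subtype.val h0.symm))
    hd₁ hd₂ hne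
  set T := AutHol.prodHom 𝓘(ℂ) Disk 𝓘(ℂ) Disk (a, b) with hT
  intro heq
  have hone := congrFun heq (bidiskVector (AutHol.directSum Γ₁ Γ₂) T)
  rw [kobayashiMetric_bidiskVector, injectiveKobayashiMetric] at hone
  -- ε may exceed 1, and 1 − ε' must be positive.
  obtain ⟨ε', hε', hε'1, hε'ε⟩ : ∃ ε' : ℝ, 0 < ε' ∧ ε' < 1 ∧ ε' ≤ ε :=
    ⟨min ε (1 / 2), lt_min hε (by norm_num), (min_le_right _ _).trans_lt (by norm_num),
      min_le_left _ _⟩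
  have hgt : (1 : ℝ) < 1 / (1 - ε') := by
    rw [lt_div_iff₀ (by linarith)]
    linarith
  obtain ⟨_, ⟨f, lam, hf, hinj, hlam, hft, rfl⟩, hlt⟩ := exists_lt_of_csInf_lt (by
    obtain ⟨f, lam, hf, hinj, hlam, hft⟩ :=
      exists_injective_tangentMap_eq_smul_bidiskVector (AutHol.directSum Γ₁ Γ₂) T
    exact ⟨1 / lam, f, lam, hf, hinj, hlam, hft, rfl⟩) (hone.trans_lt hgt)
  have hlam' : 1 - ε < lam := by
    rw [one_div_lt_one_div hlam (by linarith)] at hlt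
    linarith
  obtain ⟨G₁, G₂, hG₁, hG₂, hcov⟩ := exists_isNormalizedSelfMap_lift hf hft
  obtain ⟨ζ, hζ, ζ', hζ', e₁, e₂⟩ := hsol _ _ lam hG₁ hG₂ hlam'
  lift ζ to Disk using hζ
  lift ζ' to Disk using hζ'
  simp only [Disk.extend_coe] at e₁ e₂
  have e₁' : a • G₁ ζ = φ₁ • a • G₁ ζ' := by
    rw [Subtype.ext e₁, mul_smul, mul_smul, smul_inv_smul]
  have e₂' : b • G₂ ζ = ψ • b • G₂ ζ' := by
    rw [Subtype.ext e₂, mul_smul, mul_smul, smul_inv_smul]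
  have hff : f ζ = f ζ' := by
    rw [← hcov, ← hcov]
    refine (AutHol.Quotient.mk_eq_iff _).2 ⟨AutHol.prodHom 𝓘(ℂ) Disk 𝓘(ℂ) Disk (φ₁, ψ),
      ⟨(φ₁, ψ), ⟨hmem₁, hψmem⟩, rfl⟩, ?_⟩
    exact (Prod.ext e₁' e₂').symm
  -- With ζ = ζ', the point a(G₁ζ') would be fixed by φ₁.
  rw [hinj hff] at e₁'
  exact hfree₁ _ e₁'.symm
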